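/- **Setting.** Let $I$ be an infinite set and let $(H_i)_{i\in I}$ be a family of non-zero complex inner-product spaces, with inner products linear in the first variable. Let $\bigotimes_{i\in I}H_i$ be the algebraic tensor product, universal for multilinear maps on $\prod_{i\in I}H_i$, and let $\bigotimes^{\mathrm{un}}_{i\in I}H_i$ be the linear span of the tensors $\otimes_i x_i$ with $\|x_i\|=1$ for all $i$. For two families write $\alpha\sim\beta$ if $\alpha_i=\beta_i$ for all but finitely many $i$. Let $\mathbb T$ be the circle group and let $\Omega:=\Omega^{\mathrm{ut}}_{I;\mathbb C}:=\mathbb T^I/{\sim}$, a discrete abelian group. The algebra $\mathbb C^{\otimes I}:=\bigotimes_{i\in I}\mathbb C$ acts on $\bigotimes_{i\in I}H_i$ by $(\otimes\beta_i)(\otimes x_i)=\otimes\beta_ix_i$. Let $\langle\cdot,\cdot\rangle_{\mathbb C^{\otimes I}}$ be the sesquilinear map with $\langle\otimes x_i,\otimes y_i\rangle_{\mathbb C^{\otimes I}}=\otimes_i\langle x_i,y_i\rangle$. Let $\phi_1:\mathbb C^{\otimes I}\to\mathbb C$ be the linear functional with $\phi_1(\otimes\beta_i)=\prod_i\beta_i$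 if $\beta\sim 1$ and $\phi_1(\otimes\beta_i)=0$ otherwise. For a subgroup $G\le\Omega$ let $E_G$ be the linear map on $\mathbb C^{\otimes I}$ with $E_G(\otimes\beta_i)=\otimes\beta_i$ if $\beta\sim\alpha$ for some $\alpha\in\mathbb T^I$ with $[\alpha]\in G$, and $E_G(\otimes\beta_i)=0$ otherwise. For a group homomorphism $\varphi:\mathbb T^I\to\mathbb T$ with $\varphi(\alpha)=\prod_i\alpha_i$ whenever $\alpha\sim1$, let $\Psi_\varphi:\mathbb C[\Omega]\to\mathbb C^{\otimes I}$ be the unital algebra homomorphism with $\Psi_\varphi(\lambda_{[\alpha]})=\varphi(\alpha)^{-1}\,(\otimes\alpha_i)$. For a discrete abelian group $\Gamma$, $C^*(\Gamma)$ denotes the group $C^*$-algebra, the completion of the $*$-algebra $\mathbb C[\Gamma]$ in its largest $C^*$-seminorm. An inner-product $\mathbb C[\Gamma]$-module is a $\mathbb C[\Gamma]$-module $X$ with a $\mathbb C[\Gamma]$-valued form that is $\mathbb C[\Gamma]$-linear in the first variable, Hermitian, positive in $C^*(\Gamma)$ and definite; its completion is a Hilbert $C^*(\Gamma)$-module. If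 $A,B$ are commutative unital $C^*$-algebras, $M$ is a Hilbert $A$-module and $\mathcal E:A\to B$ is a positive linear map, $M\bar\otimes_{\mathcal E}B$ is the Hilbert $B$-module obtained as the Hausdorff completion of $M\otimes B$ with respect to $\langle x\otimes a,y\otimes b\rangle=a\,b^*\,\mathcal E(\langle x,y\rangle)$. **Theorem.** Homomorphisms $\varphi$ as above exist, and $\langle\xi,\eta\rangle_{\phi_1}:=\phi_1(\langle\xi,\eta\rangle_{\mathbb C^{\otimes I}})$ is an inner product on $\bigotimes^{\mathrm{un}}_{i\in I}H_i$; let $\bar\bigotimes^{\phi_1}_{i\in I}H_i$ be its Hilbert space completion. For every such $\varphi$ the following hold. (a) There is an inner-product $\mathbb C[\Omega]$-module structure on $\bigotimes^{\mathrm{un}}_{i\in I}H_i$ with action $a\cdot\xi=\Psi_\varphi(a)\,\xi$ and with form satisfying $\Psi_\varphi(\langle\xi,\eta\rangle)=E_\Omega(\langle\xi,\eta\rangle_{\mathbb C^{\otimes I}})$. Let $\bar\bigotimes^{\mathrm{mod}}_{i\in I}H_i$ be the Hilbert $C^*(\Omega)$-module that is its completion. The map $\sum_g a_g\lambda_g\mapsto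 a_e$ extends to a positive linear functional $\chi_\Omega$ on $C^*(\Omega)$ (the canonical tracial state), and there is a Hilbert space isomorphism $$\bar\bigotimes^{\phi_1}_{i\in I}H_i\ \cong\ \Big(\bar\bigotimes^{\mathrm{mod}}_{i\in I}H_i\Big)\,\bar\otimes_{\chi_\Omega}\,\mathbb C$$ sending $\xi$ to $\xi\otimes1$ for every $\xi\in\bigotimes^{\mathrm{un}}_{i\in I}H_i$. (b) For every subgroup $G\le\Omega$ there is an inner-product $\mathbb C[G]$-module structure on $\bigotimes^{\mathrm{un}}_{i\in I}H_i$ whose action is the restriction to $\mathbb C[G]$ of the action in (a) and whose form satisfies $\Psi_\varphi(\langle\xi,\eta\rangle_G)=E_G(\langle\xi,\eta\rangle_{\mathbb C^{\otimes I}})$. The map $\sum_{g\in\Omega}a_g\lambda_g\mapsto\sum_{g\in G}a_g\lambda_g$ extends to a positive linear map $\mathcal E_G:C^*(\Omega)\to C^*(G)$ (the canonical conditional expectation), and there is a $C^*(G)$-linear isometric isomorphism, preserving the $C^*(G)$-valued inner products, from the completion of this inner-product $\mathbb C[G]$-module onto $$\Big(\bar\bigotimes^{\mathrm{mod}}_{i\in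 I}H_i\Big)\,\bar\otimes_{\mathcal E_G}\,C^*(G),$$ sending $\xi$ to $\xi\otimes1$ for every $\xi\in\bigotimes^{\mathrm{un}}_{i\in I}H_i$. -/

import Mathlib

open scoped ComplexOrder TensorProduct
open UniformSpace

set_option linter.unusedSectionVars false

noncomputable section

namespace HilbTensor

/-! ### The group algebra of an abelian group and its enveloping C*-algebra -/

section GroupAlgebra

variable {G : Type*} [CommGroup G]

/-- The involution `(∑ a_g λ_g)* = ∑ conj(a_g) λ_{g⁻¹}` on the group algebra. -/
instance : Star (MonoidAlgebra ℂ G) where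
  star a := .ofCoeff ((a.coeff.mapRange star (star_zero ℂ)).equivMapDomain (Equiv.inv G))

lemma coeff_star (a : MonoidAlgebra ℂ G) (g : G) : (star a).coeff g = star (a.coeff g⁻¹) := rfl

lemma star_single (g : G) (z : ℂ) :
    star (MonoidAlgebra.single g z) = MonoidAlgebra.single g⁻¹ (star z) := by
  ext h
  rw [coeff_star]
  by_cases hh : g = h⁻¹
  · subst hh; simp
  · have : g⁻¹ ≠ h := fun h' => hh (by rw [← h', inv_inv])
    simp [hh, this]

lemma star_add' (a b : MonoidAlgebra ℂ G) : star (a + b) = star a + star b := by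
  ext g; simp [coeff_star]

instance : StarRing (MonoidAlgebra ℂ G) where
  star_involutive a := by ext g; simp [coeff_star]
  star_add := star_add'
  star_mul a b := by
    induction a using MonoidAlgebra.induction_linear with
    | zero =>
      have : star (0 : MonoidAlgebra ℂ G) = 0 := by ext g; simp [coeff_star]
      simp [this]
    | add x y hx hy => rw [add_mul, star_add', hx, hy, star_add', mul_add]
    | single g z =>
      induction b using MonoidAlgebra.induction_linear with
      | zero =>
        have : star (0 : MonoidAlgebra ℂ G) = 0 := by ext g; simp [coeff_star]
        simp [this]
      | add x y hx hy => rw [mul_add, star_add', hx, hy, star_add', add_mul]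
      | single h w =>
        simp only [star_single, MonoidAlgebra.single_mul_single, mul_inv_rev, star_mul]

instance : StarModule ℂ (MonoidAlgebra ℂ G) where
  star_smul z a := by ext g; simp [coeff_star]

/-- A C*-seminorm on the group algebra. -/
structure IsCStarSeminorm (p : Seminorm ℂ (MonoidAlgebra ℂ G)) : Prop where
  map_mul_le : ∀ a b, p (a * b) ≤ p a * p b
  map_star_mul_self : ∀ a, p (star a * a) = p a ^ 2

lemma IsCStarSeminorm.single_le {p : Seminorm ℂ (MonoidAlgebra ℂ G)} (hp : IsCStarSeminorm p)
    (g : G) (z : ℂ) : p (MonoidAlgebra.single g z) ≤ ‖z‖ := by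
  have h1 : p 1 ≤ 1 := by
    have h := hp.map_star_mul_self 1
    rw [star_one, one_mul] at h
    nlinarith [apply_nonneg p 1]
  have h2 := hp.map_star_mul_self (MonoidAlgebra.single g 1)
  rw [star_single, MonoidAlgebra.single_mul_single, inv_mul_cancel, star_one, one_mul,
    ← MonoidAlgebra.one_def] at h2
  have h3 : p (MonoidAlgebra.single g 1) ≤ 1 := by
    nlinarith [apply_nonneg p (MonoidAlgebra.single g 1)]
  have h4 : MonoidAlgebra.single g z = z • MonoidAlgebra.single g 1 := by simp
  rw [h4, map_smul_eq_mul]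
  exact mul_le_of_le_one_right (norm_nonneg z) h3

lemma IsCStarSeminorm.le_sum {p : Seminorm ℂ (MonoidAlgebra ℂ G)} (hp : IsCStarSeminorm p)
    (a : MonoidAlgebra ℂ G) : p a ≤ ∑ g ∈ a.coeff.support, ‖a.coeff g‖ := by
  have h : a = ∑ g ∈ a.coeff.support, MonoidAlgebra.single g (a.coeff g) := by
    apply MonoidAlgebra.coeff_injective
    rw [MonoidAlgebra.coeff_sum]
    exact (Finsupp.sum_single a.coeff).symm
  conv_lhs => rw [h]
  exact (Finset.le_sum_of_subadditive p (map_zero p).le (map_add_le_add p) _ _).trans (Finset.sum_le_sum fun g _ => hp.single_le g _)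

lemma IsCStarSeminorm.map_star {p : Seminorm ℂ (MonoidAlgebra ℂ G)} (hp : IsCStarSeminorm p)
    (a : MonoidAlgebra ℂ G) : p (star a) = p a := by
  have key : ∀ b, p b ≤ p (star b) := fun b => by
    have h1 := hp.map_star_mul_self b
    have h2 := hp.map_mul_le (star b) b
    by_contra! hlt
    nlinarith [apply_nonneg p b, apply_nonneg p (star b)]
  exact le_antisymm (by simpa using key (star a)) (key a)

lemma isCStarSeminorm_zero : IsCStarSeminorm (0 : Seminorm ℂ (MonoidAlgebra ℂ G)) :=
  ⟨fun a b => by simp, fun a => by simp⟩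

instance : Nonempty {p : Seminorm ℂ (MonoidAlgebra ℂ G) // IsCStarSeminorm p} :=
  ⟨⟨0, isCStarSeminorm_zero⟩⟩

/-- The largest C*-seminorm on the group algebra. -/
def maxNorm (a : MonoidAlgebra ℂ G) : ℝ :=
  ⨆ p : {p : Seminorm ℂ (MonoidAlgebra ℂ G) // IsCStarSeminorm p}, p.1 a

lemma le_maxNorm {p : Seminorm ℂ (MonoidAlgebra ℂ G)} (hp : IsCStarSeminorm p)
    (a : MonoidAlgebra ℂ G) : p a ≤ maxNorm a :=
  le_ciSup (f := fun p : {p : Seminorm ℂ (MonoidAlgebra ℂ G) // IsCStarSeminorm p} => p.1 a)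
    ⟨∑ g ∈ a.coeff.support, ‖a.coeff g‖, by rintro _ ⟨q, rfl⟩; exact q.2.le_sum a⟩ ⟨p, hp⟩

lemma maxNorm_le {a : MonoidAlgebra ℂ G} {r : ℝ}
    (h : ∀ p : Seminorm ℂ (MonoidAlgebra ℂ G), IsCStarSeminorm p → p a ≤ r) : maxNorm a ≤ r :=
  ciSup_le fun p => h p.1 p.2

lemma maxNorm_nonneg (a : MonoidAlgebra ℂ G) : 0 ≤ maxNorm a := by
  simpa using le_maxNorm isCStarSeminorm_zero a

lemma maxNorm_star (a : MonoidAlgebra ℂ G) : maxNorm (star a) = maxNorm a :=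
  le_antisymm (maxNorm_le fun _ hp => (hp.map_star a).trans_le (le_maxNorm hp a))
    (maxNorm_le fun _ hp => (hp.map_star a).symm.trans_le (le_maxNorm hp _))

lemma maxNorm_star_mul_self (a : MonoidAlgebra ℂ G) :
    maxNorm a * maxNorm a ≤ maxNorm (star a * a) := by
  have h : maxNorm a ≤ √(maxNorm (star a * a)) := maxNorm_le fun p hp =>
    Real.le_sqrt_of_sq_le ((hp.map_star_mul_self a).symm.trans_le (le_maxNorm hp _))
  calc _ ≤ √(maxNorm (star a * a)) * √(maxNorm (star a * a)) := by
        gcongr; exact maxNorm_nonneg a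
    _ = _ := Real.mul_self_sqrt (maxNorm_nonneg _)

variable (G) in
/-- The group algebra, equipped with the largest C*-seminorm. -/
def MaxGroupAlgebra := MonoidAlgebra ℂ G

instance : CommRing (MaxGroupAlgebra G) := inferInstanceAs (CommRing (MonoidAlgebra ℂ G))
instance : StarRing (MaxGroupAlgebra G) := inferInstanceAs (StarRing (MonoidAlgebra ℂ G))
instance : Algebra ℂ (MaxGroupAlgebra G) := inferInstanceAs (Algebra ℂ (MonoidAlgebra ℂ G))
instance : StarModule ℂ (MaxGroupAlgebra G) := inferInstanceAs (StarModule ℂ (MonoidAlgebra ℂ G))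
instance : Norm (MaxGroupAlgebra G) := ⟨fun a => maxNorm (G := G) a⟩

lemma MaxGroupAlgebra.core : SeminormedSpace.Core ℂ (MaxGroupAlgebra G) where
  norm_nonneg a := maxNorm_nonneg (G := G) a
  norm_smul z a := by
    have key : ∀ (z : ℂ) (a : MonoidAlgebra ℂ G), maxNorm (z • a) ≤ ‖z‖ * maxNorm a :=
      fun z a => maxNorm_le fun p hp => by
        rw [map_smul_eq_mul]
        exact mul_le_mul_of_nonneg_left (le_maxNorm hp a) (norm_nonneg z)
    refine le_antisymm (key z a) ?_
    rcases eq_or_ne z 0 with rfl | hz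
    · rw [norm_zero, zero_mul]; exact maxNorm_nonneg (G := G) _
    · have h := key z⁻¹ (z • (show MonoidAlgebra ℂ G from a))
      rw [smul_smul, inv_mul_cancel₀ hz, one_smul, norm_inv] at h
      have hz' : 0 < ‖z‖ := norm_pos_iff.2 hz
      calc ‖z‖ * maxNorm (show MonoidAlgebra ℂ G from a)
          ≤ ‖z‖ * (‖z‖⁻¹ * maxNorm (z • (show MonoidAlgebra ℂ G from a))) := by gcongr
        _ = _ := by rw [← mul_assoc, mul_inv_cancel₀ hz'.ne', one_mul]; rfl
  norm_triangle a b := maxNorm_le (G := G) fun p hp =>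
    (map_add_le_add p _ _).trans (add_le_add (le_maxNorm hp _) (le_maxNorm hp _))

instance : SeminormedCommRing (MaxGroupAlgebra G) where
  __ := (inferInstance : CommRing (MaxGroupAlgebra G))
  __ := SeminormedAddCommGroup.ofCore (MaxGroupAlgebra.core (G := G))
  norm_mul_le a _ := maxNorm_le (G := G) fun p hp =>
    (hp.map_mul_le _ _).trans (mul_le_mul (le_maxNorm hp _) (le_maxNorm hp _)
      (apply_nonneg p _) (maxNorm_nonneg (G := G) a))

instance : NormedAlgebra ℂ (MaxGroupAlgebra G) where
  norm_smul_le z a := (MaxGroupAlgebra.core.norm_smul z a).le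

instance : NormedStarGroup (MaxGroupAlgebra G) where
  norm_star_le a := (maxNorm_star (G := G) a).le

variable (G) in
/-- The (full) group C*-algebra `C*(G)` of the discrete abelian group `G`: the completion of the
group algebra with respect to its largest C*-seminorm. -/
def GroupCStar := UniformSpace.Completion (MaxGroupAlgebra G)

instance : NormedCommRing (GroupCStar G) :=
  inferInstanceAs (NormedCommRing (Completion (MaxGroupAlgebra G)))
instance : NormedAlgebra ℂ (GroupCStar G) :=
  inferInstanceAs (NormedAlgebra ℂ (Completion (MaxGroupAlgebra G)))
instance : CompleteSpace (GroupCStar G) :=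
  inferInstanceAs (CompleteSpace (Completion (MaxGroupAlgebra G)))

/-- The canonical map of the group algebra into the group C*-algebra, as an algebra
homomorphism. -/
def GroupCStar.ofAlg : MonoidAlgebra ℂ G →ₐ[ℂ] GroupCStar G where
  __ := (Completion.coeRingHom : MaxGroupAlgebra G →+* Completion (MaxGroupAlgebra G))
  commutes' _ := rfl

lemma GroupCStar.norm_ofAlg (a : MonoidAlgebra ℂ G) : ‖ofAlg a‖ = maxNorm a :=
  Completion.norm_coe (E := MaxGroupAlgebra G) a

lemma GroupCStar.denseRange_ofAlg : DenseRange (ofAlg : MonoidAlgebra ℂ G → GroupCStar G) :=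
  Completion.denseRange_coe (α := MaxGroupAlgebra G)

instance : Star (GroupCStar G) where
  star := Completion.map (star : MaxGroupAlgebra G → MaxGroupAlgebra G)

lemma GroupCStar.star_ofAlg (a : MonoidAlgebra ℂ G) : star (ofAlg a) = ofAlg (star a) :=
  Completion.map_coe (α := MaxGroupAlgebra G) star_isometry.uniformContinuous a

lemma GroupCStar.continuous_star : Continuous (star : GroupCStar G → GroupCStar G) :=
  Completion.continuous_map

lemma GroupCStar.induction {P : GroupCStar G → Prop} (hc : IsClosed {x | P x})
    (h : ∀ a, P (ofAlg a)) (x : GroupCStar G) : P x :=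
  denseRange_ofAlg.induction_on x hc h

lemma GroupCStar.induction₂ {P : GroupCStar G → GroupCStar G → Prop}
    (hc : IsClosed {x : GroupCStar G × GroupCStar G | P x.1 x.2})
    (h : ∀ a b, P (ofAlg a) (ofAlg b)) (x y : GroupCStar G) : P x y :=
  denseRange_ofAlg.induction_on₂ hc h x y

instance : StarRing (GroupCStar G) where
  star_involutive x := GroupCStar.induction (P := fun x => star (star x) = x)
    (isClosed_eq (GroupCStar.continuous_star.comp GroupCStar.continuous_star) continuous_id)
    (fun a => by rw [GroupCStar.star_ofAlg, GroupCStar.star_ofAlg, star_star]) x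
  star_mul x y := GroupCStar.induction₂ (P := fun x y => star (x * y) = star y * star x)
    (isClosed_eq (GroupCStar.continuous_star.comp continuous_mul)
        ((GroupCStar.continuous_star.comp continuous_snd).mul
          (GroupCStar.continuous_star.comp continuous_fst)))
    (fun a b => by
      simp only [GroupCStar.star_ofAlg, ← map_mul, star_mul]) x y
  star_add x y := GroupCStar.induction₂ (P := fun x y => star (x + y) = star x + star y)
    (isClosed_eq (GroupCStar.continuous_star.comp continuous_add)
        ((GroupCStar.continuous_star.comp continuous_fst).add
          (GroupCStar.continuous_star.comp continuous_snd)))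
    (fun a b => by
      simp only [GroupCStar.star_ofAlg, ← map_add, star_add]) x y

instance : StarModule ℂ (GroupCStar G) where
  star_smul z x := GroupCStar.induction (P := fun x => star (z • x) = star z • star x)
    (isClosed_eq (GroupCStar.continuous_star.comp (continuous_const_smul z))
      ((continuous_const_smul (star z)).comp GroupCStar.continuous_star))
    (fun a => by simp only [GroupCStar.star_ofAlg, ← map_smul, star_smul]) x

instance : CStarRing (GroupCStar G) where
  norm_mul_self_le x := GroupCStar.induction (P := fun x => ‖x‖ * ‖x‖ ≤ ‖star x * x‖)
    (isClosed_le (continuous_norm.mul continuous_norm)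
      ((GroupCStar.continuous_star.mul continuous_id).norm))
    (fun a => by
      simp only [GroupCStar.star_ofAlg, ← map_mul, GroupCStar.norm_ofAlg]
      exact maxNorm_star_mul_self a) x

instance : CommCStarAlgebra (GroupCStar G) where

instance : PartialOrder (GroupCStar G) := CStarAlgebra.spectralOrder _

instance : StarOrderedRing (GroupCStar G) := CStarAlgebra.spectralOrderedRing _

/-- The canonical *-homomorphism `ℂ[G] → C*(G)`. -/
def GroupCStar.of : MonoidAlgebra ℂ G →⋆ₐ[ℂ] GroupCStar G where
  __ := GroupCStar.ofAlg
  map_star' a := (GroupCStar.star_ofAlg a).symm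

lemma GroupCStar.denseRange_of : DenseRange (of : MonoidAlgebra ℂ G → GroupCStar G) :=
  denseRange_ofAlg

/-- The inclusion `ℂ[Γ] → ℂ[G]` for a subgroup `Γ` of `G`. -/
def includeSubgroup (Γ : Subgroup G) : MonoidAlgebra ℂ Γ →ₐ[ℂ] MonoidAlgebra ℂ G :=
  MonoidAlgebra.mapDomainAlgHom ℂ ℂ Γ.subtype

/-- The restriction `ℂ[G] → ℂ[Γ]`, `∑ a_g λ_g ↦ ∑_{g ∈ Γ} a_g λ_g`, for a subgroup `Γ` of `G`. -/
def restrictSubgroup (Γ : Subgroup G) (a : MonoidAlgebra ℂ G) : MonoidAlgebra ℂ Γ :=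
  .ofCoeff (a.coeff.comapDomain Γ.subtype Γ.subtype_injective.injOn)

end GroupAlgebra

section Characters

open WeakDual

variable {B : Type*} [CommCStarAlgebra B] [PartialOrder B] [StarOrderedRing B]

lemma char_nonneg {b : B} (hb : 0 ≤ b) (f : characterSpace ℂ B) : 0 ≤ f b := by
  obtain ⟨c, rfl⟩ := CStarAlgebra.nonneg_iff_eq_star_mul_self.1 hb
  rw [map_mul, map_star]
  exact star_mul_self_nonneg (f c)

lemma norm_char_le (b : B) (f : characterSpace ℂ B) : ‖f b‖ ≤ ‖b‖ := by
  have h := (gelfandTransform_isometry B).norm_map_of_map_zero (map_zero _) b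
  rw [← h]
  exact ContinuousMap.norm_coe_le_norm (gelfandTransform ℂ B b) f

lemma norm_le_of_char {b : B} {r : ℝ} (hr : 0 ≤ r) (h : ∀ f : characterSpace ℂ B, ‖f b‖ ≤ r) :
    ‖b‖ ≤ r := by
  have h' := (gelfandTransform_isometry B).norm_map_of_map_zero (map_zero _) b
  rw [← h']
  exact (ContinuousMap.norm_le _ hr).2 h

lemma nonneg_of_char {b : B} (h : ∀ f : characterSpace ℂ B, 0 ≤ f b) : 0 ≤ b := by
  have hsa : IsSelfAdjoint b := by
    refine (gelfandTransform_isometry B).injective (ContinuousMap.ext fun f => ?_)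
    change f (star b) = f b
    rw [map_star]
    exact (IsSelfAdjoint.of_nonneg (h f)).star_eq
  rw [StarOrderedRing.nonneg_iff_spectrum_nonneg (R := ℂ) b]
  intro z hz
  obtain ⟨f, rfl⟩ := CharacterSpace.mem_spectrum_iff_exists.1 hz
  exact h f

end Characters

/-! ### Pre-Hilbert modules over commutative C*-algebras and their completions -/

/-- A (semi-definite) pre-Hilbert module over a dense subalgebra: `A` is an algebra with a
homomorphism onto a dense subalgebra of the commutative C*-algebra `B`, and `X` is a unital left
`A`-module with a `B`-valued positive Hermitian form that is `A`-linear in the first variable. -/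
structure PreHilbertModule (A B X : Type*) [Ring A] [Algebra ℂ A] [CommCStarAlgebra B]
    [PartialOrder B] [StarOrderedRing B] [AddCommGroup X] [Module ℂ X] where
  toAlg : A →ₐ[ℂ] B
  dense : DenseRange toAlg
  act : A →ₐ[ℂ] Module.End ℂ X
  form : X → X → B
  form_add_left : ∀ x y z, form (x + y) z = form x z + form y z
  form_act_left : ∀ a x y, form (act a x) y = toAlg a * form x y
  star_form : ∀ x y, star (form x y) = form y x
  form_self_nonneg : ∀ x, 0 ≤ form x x

namespace PreHilbertModule

variable {A B X : Type*} [Ring A] [Algebra ℂ A] [CommCStarAlgebra B]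
    [PartialOrder B] [StarOrderedRing B] [AddCommGroup X] [Module ℂ X]
    (P : PreHilbertModule A B X)

lemma form_smul_left (z : ℂ) (x y : X) : P.form (z • x) y = z • P.form x y := by
  have h := P.form_act_left (algebraMap ℂ A z) x y
  rwa [AlgHom.commutes, AlgHom.commutes, Module.algebraMap_end_apply, ← Algebra.smul_def] at h

lemma form_add_right (x y z : X) : P.form x (y + z) = P.form x y + P.form x z := by
  rw [← P.star_form, P.form_add_left, star_add, P.star_form, P.star_form]

lemma form_smul_right (z : ℂ) (x y : X) : P.form x (z • y) = star z • P.form x y := by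
  rw [← P.star_form, P.form_smul_left, star_smul, P.star_form]

lemma form_act_right (a : A) (x y : X) : P.form x (P.act a y) = star (P.toAlg a) * P.form x y := by
  rw [← P.star_form, P.form_act_left, star_mul, P.star_form, mul_comm]

/-- The scalar semi-inner product obtained from a character, conjugate linear in the first
variable. -/
abbrev charCore (f : WeakDual.characterSpace ℂ B) : PreInnerProductSpace.Core ℂ X where
  inner x y := f (P.form y x)
  conj_inner_symm x y := by
    change star (f (P.form x y)) = f (P.form y x)
    rw [← map_star, P.star_form]
  re_inner_nonneg x := (Complex.nonneg_iff.1 (char_nonneg (P.form_self_nonneg x) f)).1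
  add_left x y z := by rw [P.form_add_right, map_add]
  smul_left x y z := by rw [P.form_smul_right, map_smul, smul_eq_mul]; rfl

lemma char_form_self (f : WeakDual.characterSpace ℂ B) (x : X) :
    (f (P.form x x)).re ≤ ‖P.form x x‖ :=
  (Complex.re_le_norm _).trans (norm_char_le _ f)

/-- The Cauchy-Schwarz inequality. -/
lemma norm_form_le (x y : X) : ‖P.form x y‖ ≤ √‖P.form x x‖ * √‖P.form y y‖ := by
  refine norm_le_of_char (by positivity) fun f => ?_
  let := P.charCore f
  have h := InnerProductSpace.Core.norm_inner_le_norm (𝕜 := ℂ) (F := X) y x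
  have e : ∀ x : X, @norm X (InnerProductSpace.Core.toNorm (𝕜 := ℂ) (F := X)) x
      = √(f (P.form x x)).re := fun x => rfl
  rw [e, e, mul_comm] at h
  exact h.trans (mul_le_mul (Real.sqrt_le_sqrt (P.char_form_self f x))
    (Real.sqrt_le_sqrt (P.char_form_self f y)) (Real.sqrt_nonneg _) (Real.sqrt_nonneg _))

/-- The space `X` with the seminorm `x ↦ ‖⟨x, x⟩‖^{1/2}`. -/
def Carrier (_ : PreHilbertModule A B X) := X

instance : AddCommGroup P.Carrier := inferInstanceAs (AddCommGroup X)
instance : Module ℂ P.Carrier := inferInstanceAs (Module ℂ X)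
instance : Norm P.Carrier := ⟨fun x => √‖P.form x x‖⟩

lemma norm_def (x : P.Carrier) : ‖x‖ = √‖P.form x x‖ := rfl

lemma core : SeminormedSpace.Core ℂ P.Carrier where
  norm_nonneg x := Real.sqrt_nonneg _
  norm_smul z x := by
    have h : P.form (z • show X from x) (z • show X from x) = z • star z • P.form x x := by
      rw [P.form_smul_left, P.form_smul_right]
    calc √‖P.form (z • show X from x) (z • show X from x)‖ = √(‖z‖ * ‖z‖ * ‖P.form x x‖) := by
          rw [h, norm_smul, norm_smul, norm_star, mul_assoc]
      _ = _ := by rw [Real.sqrt_mul (by positivity), Real.sqrt_mul_self (norm_nonneg z)]; rfl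
  norm_triangle x y := by
    have h : ∀ x y : X, P.form (x + y) (x + y) =
        P.form x x + P.form x y + (P.form y x + P.form y y) := fun x y => by
      rw [P.form_add_left, P.form_add_right, P.form_add_right]
    have hx := Real.mul_self_sqrt (norm_nonneg (P.form x x))
    have hy := Real.mul_self_sqrt (norm_nonneg (P.form y y))
    refine Real.sqrt_le_iff.2 ⟨add_nonneg (Real.sqrt_nonneg _) (Real.sqrt_nonneg _), ?_⟩
    calc ‖P.form (x + y : P.Carrier) (x + y : P.Carrier)‖
        ≤ ‖P.form x x‖ + ‖P.form x y‖ + (‖P.form y x‖ + ‖P.form y y‖) :=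
          (congrArg norm (h x y)).trans_le
            ((norm_add_le _ _).trans (add_le_add (norm_add_le _ _) (norm_add_le _ _)))
      _ ≤ (√‖P.form x x‖ + √‖P.form y y‖) ^ 2 := by
          nlinarith [P.norm_form_le x y, P.norm_form_le y x]

instance : SeminormedAddCommGroup P.Carrier := SeminormedAddCommGroup.ofCore P.core
instance : NormedSpace ℂ P.Carrier where
  norm_smul_le z x := (P.core.norm_smul z x).le

/-- The completion of a pre-Hilbert module (after dividing out the null vectors). -/
def Compl := Completion P.Carrier

instance : NormedAddCommGroup P.Compl := inferInstanceAs (NormedAddCommGroup (Completion P.Carrier))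
instance : NormedSpace ℂ P.Compl := inferInstanceAs (NormedSpace ℂ (Completion P.Carrier))
instance : CompleteSpace P.Compl := inferInstanceAs (CompleteSpace (Completion P.Carrier))

/-- The canonical map of `X` into the completion. -/
def toCompl : X →ₗ[ℂ] P.Compl :=
  (Completion.toComplₗᵢ : P.Carrier →ₗᵢ[ℂ] Completion P.Carrier).toLinearMap

lemma norm_toCompl (x : X) : ‖P.toCompl x‖ = √‖P.form x x‖ :=
  Completion.norm_coe (E := P.Carrier) x

lemma denseRange_toCompl : DenseRange P.toCompl :=
  Completion.denseRange_coe (α := P.Carrier)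

lemma norm_form_le' (x y : X) : ‖P.form y x‖ ≤ √‖P.form x x‖ * ‖P.toCompl y‖ := by
  rw [P.norm_toCompl, mul_comm]; exact P.norm_form_le y x

/-- The form as a map `x ↦ ⟨·, x⟩` into continuous functionals on the completion. -/
def formAux : X →ₗ⋆[ℂ] (P.Compl →L[ℂ] B) :=
  let g : X → X →ₗ[ℂ] B := fun x =>
    { toFun := fun y => P.form y x
      map_add' := fun y z => P.form_add_left y z x
      map_smul' := fun z y => P.form_smul_left z y x }
  have hg : ∀ x y, (g x).extendOfNorm P.toCompl (P.toCompl y) = P.form y x := fun x y =>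
    LinearMap.extendOfNorm_eq P.denseRange_toCompl ⟨_, P.norm_form_le' x⟩ y
  { toFun := fun x => (g x).extendOfNorm P.toCompl
    map_add' := fun x y => by
      refine ContinuousLinearMap.coeFn_injective (P.denseRange_toCompl.equalizer
        (ContinuousLinearMap.continuous _) (ContinuousLinearMap.continuous _) (funext fun z => ?_))
      simp [hg, P.form_add_right]
    map_smul' := fun c x => by
      refine ContinuousLinearMap.coeFn_injective (P.denseRange_toCompl.equalizer
        (ContinuousLinearMap.continuous _) (ContinuousLinearMap.continuous _) (funext fun z => ?_))
      simp [hg, P.form_smul_right] }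

lemma formAux_apply (x y : X) : P.formAux x (P.toCompl y) = P.form y x :=
  LinearMap.extendOfNorm_eq P.denseRange_toCompl ⟨_, P.norm_form_le' x⟩ y

lemma norm_formAux_le (x : X) : ‖P.formAux x‖ ≤ 1 * ‖P.toCompl x‖ := by
  refine ContinuousLinearMap.opNorm_le_bound _ (by positivity) fun y => ?_
  refine P.denseRange_toCompl.induction_on y (isClosed_le (by fun_prop) (by fun_prop)) fun y => ?_
  rw [formAux_apply, one_mul, P.norm_toCompl, P.norm_toCompl, mul_comm]
  exact P.norm_form_le y x

/-- The continuous extension of the form to the completion, conjugate linear in the first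
variable. -/
def innerCompl : P.Compl →L⋆[ℂ] P.Compl →L[ℂ] B := P.formAux.extendOfNorm P.toCompl

lemma innerCompl_toCompl (x y : X) : P.innerCompl (P.toCompl x) (P.toCompl y) = P.form y x := by
  rw [innerCompl, LinearMap.extendOfNorm_eq P.denseRange_toCompl ⟨1, P.norm_formAux_le⟩,
    formAux_apply]

/-- The `B`-valued inner product on the completion. As usual in Mathlib, it is linear in the second
variable: `inner B x y` is what is written `⟨y, x⟩` if the form is linear in the first variable. -/
instance : Inner B P.Compl := ⟨fun x y => P.innerCompl x y⟩

lemma inner_toCompl (x y : X) : inner B (P.toCompl x) (P.toCompl y) = P.form y x :=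
  P.innerCompl_toCompl x y

lemma inner_eq (x y : P.Compl) : inner B x y = P.innerCompl x y := rfl

lemma induction₂ {p : P.Compl → P.Compl → Prop} (hc : IsClosed {x : P.Compl × P.Compl | p x.1 x.2})
    (h : ∀ x y, p (P.toCompl x) (P.toCompl y)) (x y : P.Compl) : p x y :=
  P.denseRange_toCompl.induction_on₂ hc h x y

lemma norm_act_le (a : A) (x : X) :
    ‖P.toCompl (P.act a x)‖ ≤ ‖P.toAlg a‖ * ‖P.toCompl x‖ := by
  rw [P.norm_toCompl, P.norm_toCompl, P.form_act_left, P.form_act_right, ← mul_assoc]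
  refine Real.sqrt_le_iff.2 ⟨by positivity, ?_⟩
  rw [mul_pow, Real.sq_sqrt (norm_nonneg _)]
  refine (norm_mul_le _ _).trans ?_
  gcongr
  exact (norm_mul_le _ _).trans_eq (by rw [norm_star, sq])

/-- The action of `A` on the completion. -/
def actAux : A →ₗ[ℂ] (P.Compl →L[ℂ] P.Compl) :=
  have hg : ∀ a x, (P.toCompl ∘ₗ P.act a).extendOfNorm P.toCompl (P.toCompl x)
      = P.toCompl (P.act a x) := fun a x =>
    LinearMap.extendOfNorm_eq P.denseRange_toCompl ⟨_, P.norm_act_le a⟩ x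
  { toFun := fun a => (P.toCompl ∘ₗ P.act a).extendOfNorm P.toCompl
    map_add' := fun a b => by
      refine ContinuousLinearMap.coeFn_injective (P.denseRange_toCompl.equalizer
        (ContinuousLinearMap.continuous _) (ContinuousLinearMap.continuous _) (funext fun z => ?_))
      simp only [Function.comp_apply, add_apply, hg]
      simp
    map_smul' := fun c a => by
      refine ContinuousLinearMap.coeFn_injective (P.denseRange_toCompl.equalizer
        (ContinuousLinearMap.continuous _) (ContinuousLinearMap.continuous _) (funext fun z => ?_))
      simp only [Function.comp_apply, smul_apply, hg]
      simp }

lemma actAux_apply (a : A) (x : X) : P.actAux a (P.toCompl x) = P.toCompl (P.act a x) :=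
  LinearMap.extendOfNorm_eq P.denseRange_toCompl ⟨_, P.norm_act_le a⟩ x

lemma norm_actAux_le (a : A) : ‖P.actAux a‖ ≤ 1 * ‖P.toAlg a‖ := by
  refine ContinuousLinearMap.opNorm_le_bound _ (by positivity) fun y => ?_
  refine P.denseRange_toCompl.induction_on y (isClosed_le (by fun_prop) (by fun_prop)) fun y => ?_
  rw [actAux_apply, one_mul]
  exact P.norm_act_le a y

/-- The continuous extension of the action of `A` to an action of `B` on the completion. -/
def actCompl : B →L[ℂ] P.Compl →L[ℂ] P.Compl := P.actAux.extendOfNorm P.toAlg.toLinearMap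

lemma actCompl_toAlg (a : A) (x : X) :
    P.actCompl (P.toAlg a) (P.toCompl x) = P.toCompl (P.act a x) := by
  have h := LinearMap.extendOfNorm_eq (f := P.actAux) (e := P.toAlg.toLinearMap) P.dense
    ⟨1, P.norm_actAux_le⟩ a
  rw [← P.actAux_apply, ← h]; rfl

lemma actCompl_mul (b c : B) (x : P.Compl) :
    P.actCompl (b * c) x = P.actCompl b (P.actCompl c x) := by
  refine P.dense.induction_on₂ (p := fun b c => P.actCompl (b * c) x =
    P.actCompl b (P.actCompl c x)) (isClosed_eq (by fun_prop) (by fun_prop)) (fun a a' => ?_) b c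
  refine P.denseRange_toCompl.induction_on x (isClosed_eq (by fun_prop) (by fun_prop)) fun x => ?_
  rw [← map_mul, actCompl_toAlg, actCompl_toAlg, actCompl_toAlg, map_mul]; rfl

/-- The completion is a module over the C*-algebra `B`. The priority is low so that over `B = ℂ`
the vector space structure takes precedence. -/
instance (priority := 50) instModule : Module B P.Compl where
  smul b x := P.actCompl b x
  one_smul x := by
    change P.actCompl 1 x = x
    refine P.denseRange_toCompl.induction_on x (isClosed_eq (by fun_prop) (by fun_prop)) fun x => ?_
    rw [← map_one P.toAlg, actCompl_toAlg, map_one]; rfl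
  mul_smul b c x := P.actCompl_mul b c x
  smul_zero b := map_zero (P.actCompl b)
  smul_add b := map_add (P.actCompl b)
  add_smul b c x := by
    change P.actCompl (b + c) x = P.actCompl b x + P.actCompl c x
    rw [map_add]; rfl
  zero_smul x := by
    change P.actCompl 0 x = 0
    rw [map_zero]; rfl

lemma smul_eq (b : B) (x : P.Compl) : @HSMul.hSMul B P.Compl P.Compl
    (@instHSMul _ _ P.instModule.toSMul) b x = P.actCompl b x := rfl

lemma toAlg_smul_toCompl (a : A) (x : X) : @HSMul.hSMul B P.Compl P.Compl
    (@instHSMul _ _ P.instModule.toSMul) (P.toAlg a) (P.toCompl x) = P.toCompl (P.act a x) :=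
  P.actCompl_toAlg a x

lemma star_inner_compl (x y : P.Compl) : star (inner B x y) = inner B y x := by
  refine P.induction₂ (p := fun x y => star (inner B x y) = inner B y x)
    (isClosed_eq ?_ ?_) (fun x y => ?_) x y
  · simp only [inner_eq]; fun_prop
  · simp only [inner_eq]; fun_prop
  · rw [inner_toCompl, inner_toCompl, P.star_form]

lemma norm_eq_compl (x : P.Compl) : ‖x‖ = √‖(inner B x x : B)‖ := by
  refine P.denseRange_toCompl.induction_on x (isClosed_eq (by fun_prop) ?_) fun x => ?_
  · simp only [inner_eq]; fun_prop
  · rw [inner_toCompl, P.norm_toCompl]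

lemma inner_self_nonneg_compl (x : P.Compl) : 0 ≤ (inner B x x : B) := by
  refine P.denseRange_toCompl.induction_on x
    (CStarAlgebra.isClosed_nonneg.preimage (f := fun x : P.Compl => (inner B x x : B)) ?_)
    fun x => ?_
  · simp only [inner_eq]; fun_prop
  · rw [inner_toCompl]; exact P.form_self_nonneg x

/-- The completion is a Hilbert C*-module. -/
instance : CStarModule B P.Compl where
  inner_add_right {x y z} := map_add (P.innerCompl x) y z
  inner_self_nonneg {x} := P.inner_self_nonneg_compl x
  inner_self {x} := by
    constructor
    · intro h
      have := P.norm_eq_compl x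
      rw [h, norm_zero, Real.sqrt_zero] at this
      exact norm_eq_zero.1 this
    · rintro rfl
      exact map_zero (P.innerCompl 0)
  inner_op_smul_right {b x y} := by
    simp only [smul_eq, inner_eq]
    refine P.dense.induction_on b (isClosed_eq (by fun_prop) (by fun_prop)) fun a => ?_
    refine P.induction₂ (p := fun x y => P.innerCompl x (P.actCompl (P.toAlg a) y) =
      P.toAlg a * P.innerCompl x y) (isClosed_eq (by fun_prop) (by fun_prop)) (fun x y => ?_) x y
    rw [actCompl_toAlg, innerCompl_toCompl, innerCompl_toCompl, P.form_act_left]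
  inner_smul_right_complex {z x y} := map_smul (P.innerCompl x) z y
  star_inner := P.star_inner_compl
  norm_eq_sqrt_norm_inner_self := P.norm_eq_compl

/-- Over the C*-algebra `ℂ` the completion is a Hilbert space. -/
instance (Q : PreHilbertModule A ℂ X) : InnerProductSpace ℂ Q.Compl where
  norm_sq_eq_re_inner x := by
    rw [Q.norm_eq_compl, Real.sq_sqrt (norm_nonneg _)]
    exact (Complex.re_eq_norm.2 (Q.inner_self_nonneg_compl x)).symm
  conj_inner_symm x y := Q.star_inner_compl y x
  add_left x y z := by rw [inner_eq, map_add]; rfl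
  smul_left x y c := by rw [inner_eq, map_smulₛₗ]; rfl

end PreHilbertModule

/-! ### Interior tensor products -/

section InteriorTensor

variable {A M C : Type*} [CommCStarAlgebra A] [PartialOrder A] [StarOrderedRing A]
  [NormedAddCommGroup M] [NormedSpace ℂ M] [Module A M] [CStarModule A M]
  [CommCStarAlgebra C] [PartialOrder C] [StarOrderedRing C]

/-- The map `x ⊗ a ↦ a b* E⟨x, y⟩` for fixed `y ∈ M` and `b ∈ C`. -/
def interiorAux (E : A →ₚ[ℂ] C) (y : M) (b : C) : M ⊗[ℂ] C →ₗ[ℂ] C :=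
  TensorProduct.lift (LinearMap.mk₂ ℂ (fun (x : M) (a : C) => a * star b * E (inner A y x))
    (fun x x' a => by rw [CStarModule.inner_add_right, map_add, mul_add])
    (fun z x a => by rw [CStarModule.inner_smul_right_complex, map_smul, mul_smul_comm])
    (fun x a a' => by rw [add_mul, add_mul])
    (fun z x a => by rw [smul_mul_assoc, smul_mul_assoc]))

lemma interiorAux_tmul (E : A →ₚ[ℂ] C) (y : M) (b : C) (x : M) (a : C) :
    interiorAux E y b (x ⊗ₜ a) = a * star b * E (inner A y x) := rfl

/-- The `C`-valued form on `M ⊗ C` with `⟨x ⊗ a, y ⊗ b⟩ = a b* E⟨x, y⟩`, as a function of its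
second and then its first argument. -/
def interiorForm (M : Type*) [NormedAddCommGroup M] [NormedSpace ℂ M] [Module A M]
    [CStarModule A M] (E : A →ₚ[ℂ] C) : M ⊗[ℂ] C →ₗ⋆[ℂ] M ⊗[ℂ] C →ₗ[ℂ] C :=
  TensorProduct.lift (LinearMap.mk₂'ₛₗ (starRingEnd ℂ) (starRingEnd ℂ)
    (fun (y : M) (b : C) => interiorAux E y b)
    (fun y y' b => TensorProduct.ext' fun x a => by
      simp only [interiorAux_tmul, LinearMap.add_apply, CStarModule.inner_add_left, map_add,
        mul_add])
    (fun z y b => TensorProduct.ext' fun x a => by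
      simp only [interiorAux_tmul, LinearMap.smul_apply, CStarModule.inner_smul_left_complex,
        map_smul, mul_smul_comm]; rfl)
    (fun y b b' => TensorProduct.ext' fun x a => by
      simp only [interiorAux_tmul, LinearMap.add_apply, star_add, mul_add, add_mul])
    (fun z y b => TensorProduct.ext' fun x a => by
      simp only [interiorAux_tmul, LinearMap.smul_apply, star_smul, mul_smul_comm,
        smul_mul_assoc]; rfl))

lemma interiorForm_tmul (E : A →ₚ[ℂ] C) (x y : M) (a b : C) :
    interiorForm M E (y ⊗ₜ b) (x ⊗ₜ a) = a * star b * E (inner A y x) := rfl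

/-- The map `M ⊗ C → M`, `x ⊗ a ↦ f(a) x` given by a character `f` of `C`. -/
def charCollapse (M : Type*) [NormedAddCommGroup M] [NormedSpace ℂ M]
    (f : WeakDual.characterSpace ℂ C) : M ⊗[ℂ] C →ₗ[ℂ] M :=
  TensorProduct.lift (LinearMap.mk₂ ℂ (fun (x : M) (a : C) => f a • x)
    (fun x x' a => by rw [smul_add]) (fun z x a => by rw [smul_comm])
    (fun x a a' => by rw [map_add, add_smul])
    (fun z x a => by rw [map_smul, smul_assoc]))

lemma char_interiorForm (E : A →ₚ[ℂ] C) (f : WeakDual.characterSpace ℂ C) (s t : M ⊗[ℂ] C) :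
    f (interiorForm M E s t) = f (E (inner A (charCollapse M f s) (charCollapse M f t))) := by
  induction s using TensorProduct.induction_on with
  | zero => simp
  | add s s' hs hs' => simp only [map_add, LinearMap.add_apply, CStarModule.inner_add_left, hs, hs']
  | tmul y b =>
    induction t using TensorProduct.induction_on with
    | zero => simp
    | add t t' ht ht' => simp only [map_add, CStarModule.inner_add_right, ht, ht']
    | tmul x a =>
      change f (a * star b * E (inner A y x)) = f (E (inner A (f b • y) (f a • x)))
      simp only [CStarModule.inner_smul_left_complex, CStarModule.inner_smul_right_complex,
        map_smul, map_mul, map_star, smul_eq_mul]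
      ring

/-- The interior tensor product `M ⊗_E C` of a Hilbert `A`-module `M` with the commutative
C*-algebra `C` along a positive map `E : A → C`, before completion: the space `M ⊗ C` with the
`C`-valued form `⟨x ⊗ a, y ⊗ b⟩ = a b* E⟨x, y⟩` and with `C` acting on the second factor.
(A positive map into a commutative C*-algebra is completely positive.) -/
def interiorTensor (M : Type*) [NormedAddCommGroup M] [NormedSpace ℂ M] [Module A M]
    [CStarModule A M] (E : A →ₚ[ℂ] C) : PreHilbertModule C C (M ⊗[ℂ] C) where
  toAlg := AlgHom.id ℂ C
  dense := denseRange_id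
  act :=
    { toFun := fun c => LinearMap.lTensor M (LinearMap.mulLeft ℂ c)
      map_one' := by ext; simp
      map_mul' := fun c d => by ext; simp
      map_zero' := by ext; simp
      map_add' := fun c d => by ext; simp [add_mul, TensorProduct.tmul_add]
      commutes' := fun z => by ext; simp [Algebra.algebraMap_eq_smul_one] }
  form t s := interiorForm M E s t
  form_add_left t t' s := map_add _ t t'
  form_act_left c t s := by
    induction t using TensorProduct.induction_on with
    | zero => simp
    | add t t' ht ht' => rw [map_add, map_add, map_add, mul_add, ht, ht']
    | tmul x a =>
      induction s using TensorProduct.induction_on with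
      | zero => simp
      | add s s' hs hs' => rw [map_add, LinearMap.add_apply, LinearMap.add_apply, mul_add, hs, hs']
      | tmul y b =>
        change (c * a) * star b * E (inner A y x) = c * (a * star b * E (inner A y x))
        ring
  star_form t s := by
    refine (gelfandTransform_isometry C).injective (ContinuousMap.ext fun f => ?_)
    change f (star (interiorForm M E s t)) = f (interiorForm M E t s)
    rw [map_star, char_interiorForm, char_interiorForm, ← map_star, ← map_star,
      CStarModule.star_inner]
  form_self_nonneg t := nonneg_of_char fun f => by
    rw [char_interiorForm]
    exact char_nonneg (map_nonneg E CStarModule.inner_self_nonneg) f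

end InteriorTensor

/-! ### Inner-product modules over group algebras -/

/-- An inner-product `ℂ[G]`-module structure on a complex vector space `X`, where `ℂ[G]` is regarded
as a pre-C*-algebra in `C*(G)`: a unital `ℂ[G]`-module structure that extends the vector space
structure, with a positive definite Hermitian `ℂ[G]`-valued form that is `ℂ[G]`-linear in the first
variable. -/
structure GroupInnerModule (G X : Type*) [CommGroup G] [AddCommGroup X] [Module ℂ X] where
  act : MonoidAlgebra ℂ G →ₐ[ℂ] Module.End ℂ X
  form : X → X → MonoidAlgebra ℂ G
  form_add_left : ∀ x y z, form (x + y) z = form x z + form y z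
  form_act_left : ∀ a x y, form (act a x) y = a * form x y
  star_form : ∀ x y, star (form x y) = form y x
  form_self_nonneg : ∀ x, 0 ≤ GroupCStar.of (form x x)
  form_definite : ∀ x, form x x = 0 → x = 0

namespace GroupInnerModule

variable {G X : Type*} [CommGroup G] [AddCommGroup X] [Module ℂ X]

/-- An inner-product `ℂ[G]`-module, with its form regarded as `C*(G)`-valued. -/
def toPre (S : GroupInnerModule G X) : PreHilbertModule (MonoidAlgebra ℂ G) (GroupCStar G) X where
  toAlg := GroupCStar.of.toAlgHom
  dense := GroupCStar.denseRange_of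
  act := S.act
  form x y := GroupCStar.of (S.form x y)
  form_add_left x y z := by rw [S.form_add_left, map_add]
  form_act_left a x y := by rw [S.form_act_left, map_mul]; rfl
  star_form x y := by rw [← map_star, S.star_form]
  form_self_nonneg := S.form_self_nonneg

/-- The Hilbert `C*(G)`-module obtained by completing an inner-product `ℂ[G]`-module. -/
abbrev Compl (S : GroupInnerModule G X) := S.toPre.Compl

/-- The canonical map into the completion. -/
abbrev toCompl (S : GroupInnerModule G X) : X →ₗ[ℂ] S.Compl := S.toPre.toCompl

end GroupInnerModule

/-! ### Completion of an inner-product space -/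

section HilbertCompletion

variable {V : Type*} [AddCommGroup V] [Module ℂ V]

/-- The vector space `V` with the inner product `c`. -/
def InnerSpace (_ : InnerProductSpace.Core ℂ V) := V

variable (c : InnerProductSpace.Core ℂ V)

instance : NormedAddCommGroup (InnerSpace c) :=
  InnerProductSpace.Core.toNormedAddCommGroup (𝕜 := ℂ) (F := V) (cd := c)
instance : InnerProductSpace ℂ (InnerSpace c) :=
  InnerProductSpace.ofCore (𝕜 := ℂ) (F := V) c.toCore

/-- The Hilbert space completion of the inner-product space `(V, c)`. -/
abbrev HilbertCompletion := Completion (InnerSpace c)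

/-- The canonical map into the Hilbert space completion. -/
def toHilbertCompletion : V →ₗ[ℂ] HilbertCompletion c :=
  (Completion.toComplₗᵢ : InnerSpace c →ₗᵢ[ℂ] Completion (InnerSpace c)).toLinearMap

end HilbertCompletion

/-! ### Infinite tensor products

`⨂[ℂ] i, H i` is the algebraic tensor product of the whole (possibly infinite) family, i.e. the
universal object for maps on `Π i, H i` that are linear in every coordinate. -/

section InfiniteTensor

open PiTensorProduct Filter Function

/-- Two families agree "e.f.", i.e. up to a finite number of indices. -/
abbrev AgreeEF {I : Type*} {X : I → Type*} (x y : Π i, X i) : Prop := ∀ᶠ i in cofinite, x i = y i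

lemma agreeEF_update {I : Type*} [DecidableEq I] {X : I → Type*} (x : Π i, X i) (j : I) (a : X j) :
    AgreeEF (update x j a) x := by
  have h : {i | ¬ update x j a i = x i} ⊆ {j} := fun i hi => by
    by_contra hne
    exact hi (update_of_ne hne a x)
  exact (Set.finite_singleton j).subset h

lemma agreeEF_update_iff {I : Type*} [DecidableEq I] {X : I → Type*} (x y : Π i, X i) (j : I)
    (a : X j) : AgreeEF (update x j a) y ↔ AgreeEF x y := by
  have h := agreeEF_update x j a
  constructor <;> intro h' <;> filter_upwards [h, h'] with i hi hi'
  · rw [← hi, hi']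
  · rw [hi, hi']

variable (I : Type*)

/-- The families of complex numbers of modulus one that are equal to `1` e.f. -/
def finCircle : Subgroup (I → Circle) where
  carrier := {α | AgreeEF α 1}
  one_mem' := (Eventually.of_forall fun _ => rfl : AgreeEF (1 : I → Circle) 1)
  mul_mem' {α β} hα hβ := (by
    filter_upwards [(hα : AgreeEF α 1), (hβ : AgreeEF β 1)] with i h h'
    simp [h, h'] : AgreeEF (α * β) 1)
  inv_mem' {α} hα := (by
    filter_upwards [(hα : AgreeEF α 1)] with i h
    simp [h] : AgreeEF α⁻¹ 1)

/-- The group `Ω` of families of complex numbers of modulus one, modulo equality e.f. -/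
abbrev OmegaUt := (I → Circle) ⧸ finCircle I

/-- The algebra `ℂ^{⊗I}`. -/
abbrev CTensor := ⨂[ℂ] _ : I, ℂ

variable {I}

lemma finprod_update_eq [DecidableEq I] (β : I → ℂ) (hβ : AgreeEF β 1) (j : I) (a : ℂ) :
    ∏ᶠ i, update β j a i = a * ∏ᶠ i, update β j 1 i := by
  have h1 : (mulSupport (Pi.mulSingle j a : I → ℂ)).Finite :=
    (Set.finite_singleton j).subset Pi.mulSupport_mulSingle_subset
  have h2 : (mulSupport (update β j 1)).Finite := (agreeEF_update_iff β 1 j 1).2 hβ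
  have h3 : ∀ i, update β j a i = (Pi.mulSingle j a : I → ℂ) i * update β j 1 i := fun i => by
    rcases eq_or_ne i j with rfl | hi
    · simp
    · simp [hi]
  rw [finprod_congr h3, finprod_mul_distrib h1 h2]
  congr 1
  rw [finprod_eq_single _ j fun i hi => by simp [hi]]
  simp

open Classical in
/-- `β ↦ ∏ β_i` if `β_i = 1` e.f., and `β ↦ 0` otherwise. -/
def finiteProd : MultilinearMap ℂ (fun _ : I => ℂ) ℂ where
  toFun β := if AgreeEF β 1 then ∏ᶠ i, β i else 0
  map_update_add' β j a b := by
    simp only [agreeEF_update_iff]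
    split_ifs with h
    · rw [finprod_update_eq β h j (a + b), finprod_update_eq β h j a, finprod_update_eq β h j b,
        add_mul]
    · simp
  map_update_smul' β j z a := by
    simp only [agreeEF_update_iff]
    split_ifs with h
    · rw [finprod_update_eq β h j (z • a), finprod_update_eq β h j a, smul_mul_assoc]
    · simp

variable (I) in
/-- The linear functional `φ₁` on `ℂ^{⊗I}`. -/
def phiOne : CTensor I →ₗ[ℂ] ℂ := lift finiteProd

open Classical in
/-- The projection of `ℂ^{⊗I}` onto the span of the tensors `⊗ β_i` such that `β` is equal e.f. to a
family of complex numbers of modulus one whose class belongs to `G`; it annihilates the other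
elementary tensors. -/
def truncation (G : Subgroup (OmegaUt I)) : CTensor I →ₗ[ℂ] CTensor I :=
  lift
    { toFun := fun β =>
        if ∃ α : I → Circle, (QuotientGroup.mk α : OmegaUt I) ∈ G ∧ AgreeEF β (fun i => (α i : ℂ))
        then tprod ℂ β else 0
      map_update_add' := fun β j a b => by
        simp only [agreeEF_update_iff]
        split_ifs
        · exact MultilinearMap.map_update_add _ β j a b
        · simp
      map_update_smul' := fun β j z a => by
        simp only [agreeEF_update_iff]
        split_ifs
        · exact MultilinearMap.map_update_smul _ β j z a
        · simp }

variable (I) in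
/-- A group homomorphism from the families of complex numbers of modulus one to the circle that
sends a family with `α_i = 1` e.f. to the product of its members. -/
structure CircleProd where
  toHom : (I → Circle) →* Circle
  map_fin : ∀ α : I → Circle, AgreeEF α 1 → toHom α = ∏ᶠ i, α i

lemma tprod_circle_eq (α : I → Circle) (hα : AgreeEF α 1) :
    tprod ℂ (fun i => (α i : ℂ)) = ((∏ᶠ i, α i : Circle) : ℂ) • (1 : CTensor I) := by
  classical
  have hs : (mulSupport α).Finite := hα
  have h := (tprod ℂ : MultilinearMap ℂ (fun _ : I => ℂ) (CTensor I)).map_piecewise_smul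
    (fun i => (α i : ℂ)) (fun _ => 1) hs.toFinset
  rw [finprod_eq_prod_of_mulSupport_subset (s := hs.toFinset) α (by simp)]
  have e : hs.toFinset.piecewise (fun i => (α i : ℂ) • (1 : ℂ)) (fun _ => 1)
      = fun i => (α i : ℂ) := by
    funext i
    by_cases hi : i ∈ hs.toFinset
    · simp [hi]
    · have : α i = 1 := by simpa using hi
      simp [this]
  rw [e] at h
  rw [h, one_def]
  congr 1
  exact (map_prod Circle.coeHom _ _).symm

/-- The homomorphism `[α] ↦ φ(α)⁻¹ ⊗ α_i`. -/
def omegaHom (φ : CircleProd I) : OmegaUt I →* CTensor I :=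
  QuotientGroup.lift (finCircle I)
    { toFun := fun α => ((φ.toHom α)⁻¹ : ℂ) • tprod ℂ (fun i => (α i : ℂ))
      map_one' := by
        simp [one_def]; rfl
      map_mul' := fun α β => by
        rw [smul_tprod_mul_smul_tprod, map_mul, Circle.coe_mul, mul_inv]
        congr 2 }
    (fun α hα => by
      change ((φ.toHom α)⁻¹ : ℂ) • tprod ℂ (fun i => (α i : ℂ)) = 1
      rw [tprod_circle_eq α hα, φ.map_fin α hα, smul_smul, inv_mul_cancel₀ (Circle.coe_ne_zero _),
        one_smul])

/-- The algebra homomorphism `ℂ[Ω] → ℂ^{⊗I}`, `λ_{[α]} ↦ φ(α)⁻¹ ⊗ α_i`, by which `ℂ[Ω]` is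
identified with the span of the tensors `⊗ α_i` of families of complex numbers of modulus one. -/
def omegaAlg (φ : CircleProd I) : MonoidAlgebra ℂ (OmegaUt I) →ₐ[ℂ] CTensor I :=
  MonoidAlgebra.lift ℂ (CTensor I) (OmegaUt I) (omegaHom φ)

variable (H : I → Type*) [∀ i, NormedAddCommGroup (H i)] [∀ i, InnerProductSpace ℂ (H i)]

/-- The span of the tensors `⊗ x_i` of families of unit vectors. -/
def unTensor : Submodule ℂ (⨂[ℂ] i, H i) :=
  Submodule.span ℂ {ξ | ∃ x : Π i, H i, (∀ i, ‖x i‖ = 1) ∧ ξ = tprod ℂ x}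

/-- The action of `ℂ^{⊗I}` on `⊗ H_i`, `(⊗ β_i) · (⊗ x_i) = ⊗ β_i x_i`. -/
def tensorAct : CTensor I →ₗ[ℂ] (⨂[ℂ] i, H i) →ₗ[ℂ] ⨂[ℂ] i, H i :=
  PiTensorProduct.map₂ fun i => LinearMap.lsmul ℂ (H i)

lemma tensorAct_tprod (β : I → ℂ) (x : Π i, H i) :
    tensorAct H (tprod ℂ β) (tprod ℂ x) = tprod ℂ fun i => β i • x i := by
  simp [tensorAct, map₂_tprod_tprod]

/-- The linear map `⊗ x_i ↦ ⊗ ⟨x_i, y_i⟩`, where the inner products are linear in `x_i`. -/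
def formLeft (y : Π i, H i) : (⨂[ℂ] i, H i) →ₗ[ℂ] CTensor I :=
  PiTensorProduct.mapMultilinear ℂ H (fun _ => ℂ) fun i => innerₛₗ ℂ (y i)

lemma formLeft_update_add [DecidableEq I] (y : Π i, H i) (j : I) (a b : H j) :
    formLeft H (update y j (a + b)) = formLeft H (update y j a) + formLeft H (update y j b) := by
  have e : ∀ c : H j, (fun i => innerₛₗ ℂ (update y j c i))
      = update (fun i => innerₛₗ ℂ (y i)) j (innerₛₗ ℂ c) := fun c => by
    funext i
    rcases eq_or_ne i j with rfl | hi
    · simp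
    · simp [hi]
  simp only [formLeft, e, map_add, MultilinearMap.map_update_add]

lemma formLeft_update_smul [DecidableEq I] (y : Π i, H i) (j : I) (z : ℂ) (a : H j) :
    formLeft H (update y j (z • a)) = starRingEnd ℂ z • formLeft H (update y j a) := by
  have e : ∀ c : H j, (fun i => innerₛₗ ℂ (update y j c i))
      = update (fun i => innerₛₗ ℂ (y i)) j (innerₛₗ ℂ c) := fun c => by
    funext i
    rcases eq_or_ne i j with rfl | hi
    · simp
    · simp [hi]
  simp only [formLeft, e, map_smulₛₗ, MultilinearMap.map_update_smul]

/-- The `ℂ^{⊗I}`-valued Hermitian form on `⊗ H_i` that sends `(⊗ x_i, ⊗ y_i)` to `⊗ ⟨x_i, y_i⟩`,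
where the inner products are linear in `x_i`. -/
def tensorForm (ξ η : ⨂[ℂ] i, H i) : CTensor I :=
  liftAddHom (F := (⨂[ℂ] i, H i) →ₗ[ℂ] CTensor I)
    (fun p => (starRingEnd ℂ p.1) • formLeft H p.2)
    (fun z y i hi => by
      have : formLeft H y = 0 := MultilinearMap.map_coord_zero _ i (by simp [hi])
      simp [this])
    (fun y => by simp)
    (fun z y i a b => by rw [formLeft_update_add, smul_add])
    (fun z w y => by simp [add_smul])
    (fun z y i r => by
      rw [formLeft_update_smul, update_eq_self, smul_smul, map_mul, mul_comm]) η ξ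

lemma tensorForm_tprod (x y : Π i, H i) :
    tensorForm H (tprod ℂ x) (tprod ℂ y) = tprod ℂ fun i => inner ℂ (y i) (x i) := by
  have h : tensorForm H (tprod ℂ x) (tprod ℂ y)
      = (starRingEnd ℂ 1 • formLeft H y) (tprod ℂ x) := rfl
  rw [h, map_one, one_smul]
  simp [formLeft]

end InfiniteTensor

end HilbTensor

end

open HilbTensor

/-! All the forms in the theorem come from one `ℂ[Ω]`-valued form. Write `Ψ` for `omegaAlg φ`. The
functional `φ₁ ∘ Ψ` is the coefficient at the identity (`phiOne_omegaAlg`), and translating by group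
elements recovers every coefficient, so `Ψ` is injective. Its range is the span of the tensors `⊗
α_i` of circle families, onto which `truncation ⊤` projects. Truncating the `ℂ^{⊗I}`-valued form and
inverting `Ψ` therefore gives a form `omegaForm` with values in `ℂ[Ω]`. Under this identification
`E_G` restricts the coefficients to `G` (`omegaAlg_restrict_omegaCoord`), and `φ₁` takes the
coefficient at `1` (`omegaCoord_coeff_one`).

Positivity and definiteness come from an orthonormal expansion. Finitely many tensors of unit
vectors lie in the `ℂ[Ω]`-span of tensors that are orthonormal for `omegaForm`
(`exists_orthonormal_families`). Hence every `ξ` in `⊗^un H_i` is a finite sum `∑ a_e · e` with `⟨ξ,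
ξ⟩ = ∑ a_e a_e*`. This is positive, and its coefficient at `1` is the sum of the squared moduli of
all coefficients of the `a_e`, which vanishes only for `ξ = 0`. That settles the `ℂ[Ω]`-form and the
scalar form `φ₁⟨ξ, η⟩`, and also the `ℂ[G]`-forms, because restriction to `G` is positive and keeps
the coefficient at `1`.

The trace and the conditional expectation extend to `C*(Ω)` because a positive functional on the
group algebra is bounded for the largest C*-seminorm, by the GNS construction
(`exists_positive_extension`). Positivity of the conditional expectation on `ℂ[Ω]` follows from the
coset decomposition (`restrictₗ_mul_star`).

Both isomorphisms extend `ξ ↦ ξ ⊗ 1`, which preserves the forms. Its range is dense because `ξ ⊗ a =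
aξ ⊗ 1` for `a` in `ℂ[G]` (or in `ℂ`), a consequence of the `ℂ[G]`-linearity of the expectation.
Homomorphisms `φ` exist because the circle is divisible, hence injective as an abelian group. -/

noncomputable section

namespace HilbTensor

/-! ### Positive functionals on the group algebra: GNS bound and extension to `C*(G)`. -/

section PositiveFunctional

variable {G : Type*} [CommGroup G]

/-- The semi-inner product `⟨a, b⟩ = τ(a b*)` on the group algebra given by a positive linear
functional `τ`. -/
def gnsModule (τ : MonoidAlgebra ℂ G →ₗ[ℂ] ℂ) (hs : ∀ a, τ (star a) = star (τ a))
    (hp : ∀ a, 0 ≤ τ (a * star a)) : PreHilbertModule ℂ ℂ (MonoidAlgebra ℂ G) where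
  toAlg := AlgHom.id ℂ ℂ
  dense := denseRange_id
  act := Algebra.ofId ℂ _
  form x y := τ (x * star y)
  form_add_left x y z := by rw [add_mul, map_add]
  form_act_left a x y := by
    simp [Algebra.ofId_apply, Module.algebraMap_end_apply]
  star_form x y := by rw [← hs, star_mul, star_star]
  form_self_nonneg := hp

section GNS

variable {τ : MonoidAlgebra ℂ G →ₗ[ℂ] ℂ} {hs : ∀ a, τ (star a) = star (τ a)}
  {hp : ∀ a, 0 ≤ τ (a * star a)}

lemma gns_norm_mul_self (x : MonoidAlgebra ℂ G) :
    ‖(show (gnsModule τ hs hp).Carrier from x)‖ * ‖(show (gnsModule τ hs hp).Carrier from x)‖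
      = ‖τ (x * star x)‖ :=
  Real.mul_self_sqrt (norm_nonneg _)

-- Each `λ_g` is unitary, so `z λ_g` scales the GNS seminorm by exactly `‖z‖`; finite sums of
-- bounded operators are bounded.
variable (hs hp) in
lemma gns_bounded (a : MonoidAlgebra ℂ G) : ∃ K : ℝ, ∀ x : (gnsModule τ hs hp).Carrier,
    ‖(show (gnsModule τ hs hp).Carrier from a * (show MonoidAlgebra ℂ G from x))‖ ≤ K * ‖x‖ := by
  induction a using MonoidAlgebra.induction_linear with
  | zero =>
    refine ⟨0, fun x => ?_⟩
    rw [zero_mul, zero_mul]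
    exact (norm_zero (E := (gnsModule τ hs hp).Carrier)).le
  | add a b ha hb =>
    obtain ⟨K, hK⟩ := ha
    obtain ⟨L, hL⟩ := hb
    refine ⟨K + L, fun x => ?_⟩
    rw [add_mul, add_mul]
    exact (norm_add_le (E := (gnsModule τ hs hp).Carrier) _ _).trans (add_le_add (hK x) (hL x))
  | single g z =>
    refine ⟨‖z‖, fun (x : MonoidAlgebra ℂ G) => ?_⟩
    have h : (MonoidAlgebra.single g z * x) * star (MonoidAlgebra.single g z * x) =
        (z * star z) • (x * star x) := by
      rw [star_mul, star_single, mul_comm (star x), mul_mul_mul_comm,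
        MonoidAlgebra.single_mul_single, mul_inv_cancel,
        show MonoidAlgebra.single (1 : G) (z * star z) = (z * star z) • 1 by
          simp [MonoidAlgebra.one_def], smul_mul_assoc, one_mul]
    refine nonneg_le_nonneg_of_sq_le_sq (mul_nonneg (norm_nonneg z) (norm_nonneg _)) ?_
    rw [mul_mul_mul_comm]
    refine (gns_norm_mul_self (hs := hs) (hp := hp) (MonoidAlgebra.single g z * x)).trans_le ?_
    refine le_of_le_of_eq ?_
      (congrArg (‖z‖ * ‖z‖ * ·) (gns_norm_mul_self (hs := hs) (hp := hp) x).symm)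
    rw [h, map_smul, norm_smul, norm_mul, norm_star]

variable (hs hp) in
/-- Left multiplication as a bounded operator with respect to the seminorm of `gnsModule`. -/
def gnsMul (a : MonoidAlgebra ℂ G) :
    (gnsModule τ hs hp).Carrier →L[ℂ] (gnsModule τ hs hp).Carrier :=
  LinearMap.mkContinuousOfExistsBound (LinearMap.mulLeft ℂ a : Module.End ℂ (MonoidAlgebra ℂ G))
    (gns_bounded hs hp a)

lemma gnsMul_apply (a x : MonoidAlgebra ℂ G) : gnsMul hs hp a x = a * x := rfl

lemma gns_norm_apply_le (a b : MonoidAlgebra ℂ G) : ‖τ (a * star b)‖ ≤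
    ‖(show (gnsModule τ hs hp).Carrier from a)‖ * ‖(show (gnsModule τ hs hp).Carrier from b)‖ :=
  (gnsModule τ hs hp).norm_form_le a b

variable (hs hp) in
/-- The operator seminorm of the left multiplication. -/
def gnsSeminorm : Seminorm ℂ (MonoidAlgebra ℂ G) :=
  Seminorm.of (fun a => ‖gnsMul hs hp a‖)
    (fun a b => by
      have : gnsMul hs hp (a + b) = gnsMul hs hp a + gnsMul hs hp b :=
        ContinuousLinearMap.ext fun x => add_mul a b (show MonoidAlgebra ℂ G from x)
      rw [this]; exact norm_add_le _ _)
    (fun z a => by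
      have : gnsMul hs hp (z • a) = z • gnsMul hs hp a :=
        ContinuousLinearMap.ext fun x => smul_mul_assoc z a (show MonoidAlgebra ℂ G from x)
      rw [this]; exact norm_smul _ _)

/-- Since `‖ax‖² = |τ((a*a x) x*)| ≤ ‖a*a x‖ ‖x‖` by Cauchy-Schwarz, the operator seminorm satisfies
`p(a)² ≤ p(a*a)`. With submultiplicativity this forces `p(a) ≤ p(a*)`, and the reverse inequality in
the C*-identity follows. -/
lemma isCStarSeminorm_gnsSeminorm : IsCStarSeminorm (gnsSeminorm hs hp) := by
  have hmul : ∀ a b, gnsSeminorm hs hp (a * b) ≤ gnsSeminorm hs hp a * gnsSeminorm hs hp b :=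
    fun a b => by
      have : gnsMul hs hp (a * b) = gnsMul hs hp a ∘L gnsMul hs hp b :=
        ContinuousLinearMap.ext fun x => mul_assoc a b (show MonoidAlgebra ℂ G from x)
      change ‖gnsMul hs hp (a * b)‖ ≤ ‖gnsMul hs hp a‖ * ‖gnsMul hs hp b‖
      rw [this]
      exact ContinuousLinearMap.opNorm_comp_le _ _
  have hsq : ∀ a, gnsSeminorm hs hp a ^ 2 ≤ gnsSeminorm hs hp (star a * a) := fun a => by
    have h : ‖gnsMul hs hp a‖ ≤ √‖gnsMul hs hp (star a * a)‖ := by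
      refine ContinuousLinearMap.opNorm_le_bound _ (Real.sqrt_nonneg _) fun x => ?_
      refine nonneg_le_nonneg_of_sq_le_sq (by positivity) ?_
      rw [mul_mul_mul_comm, Real.mul_self_sqrt (norm_nonneg _)]
      have e : (a * (show MonoidAlgebra ℂ G from x)) * star (a * (show MonoidAlgebra ℂ G from x)) =
          (star a * a * (show MonoidAlgebra ℂ G from x)) *
            star (show MonoidAlgebra ℂ G from x) := by
        rw [star_mul]; ring
      calc _ = ‖τ ((a * (show MonoidAlgebra ℂ G from x)) *
            star (a * (show MonoidAlgebra ℂ G from x)))‖ := gns_norm_mul_self _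
        _ ≤ ‖gnsMul hs hp (star a * a) x‖ * ‖x‖ := by rw [e]; exact gns_norm_apply_le _ _
        _ ≤ ‖gnsMul hs hp (star a * a)‖ * ‖x‖ * ‖x‖ := by
          gcongr; exact ContinuousLinearMap.le_opNorm _ _
        _ = _ := mul_assoc _ _ _
    calc ‖gnsMul hs hp a‖ ^ 2 ≤ √‖gnsMul hs hp (star a * a)‖ ^ 2 := by gcongr
      _ = _ := Real.sq_sqrt (norm_nonneg _)
  have hle : ∀ a, gnsSeminorm hs hp a ≤ gnsSeminorm hs hp (star a) := fun a => by
    have h1 := hsq a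
    have h2 := hmul (star a) a
    by_contra! hlt
    nlinarith [apply_nonneg (gnsSeminorm hs hp) a, apply_nonneg (gnsSeminorm hs hp) (star a)]
  refine ⟨hmul, fun a => le_antisymm ((hmul _ _).trans ?_) (hsq a)⟩
  rw [sq]
  gcongr
  simpa using hle (star a)

end GNS

/-- A positive linear functional on the group algebra is bounded for the largest C*-seminorm. -/
lemma norm_positive_functional_le (τ : MonoidAlgebra ℂ G →ₗ[ℂ] ℂ)
    (hs : ∀ a, τ (star a) = star (τ a)) (hp : ∀ a, 0 ≤ τ (a * star a)) (a : MonoidAlgebra ℂ G) :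
    ‖τ a‖ ≤ ‖τ 1‖ * maxNorm a := by
  -- `|τ(a)| = |τ(a 1*)| ≤ ‖a‖_τ ‖1‖_τ ≤ p(a) ‖1‖_τ²`, where `p` is the GNS operator seminorm, `p ≤
  -- maxNorm` and `‖1‖_τ² = |τ(1)|`.
  have h1 := gns_norm_apply_le (hs := hs) (hp := hp) a 1
  have h2 := gns_norm_mul_self (hs := hs) (hp := hp) 1
  have h3 : ‖(show (gnsModule τ hs hp).Carrier from a)‖ ≤
      maxNorm a * ‖(show (gnsModule τ hs hp).Carrier from (1 : MonoidAlgebra ℂ G))‖ := by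
    have h := (gnsMul hs hp a).le_opNorm (1 : MonoidAlgebra ℂ G)
    rw [gnsMul_apply, mul_one] at h
    exact h.trans (mul_le_mul_of_nonneg_right
      (le_maxNorm (isCStarSeminorm_gnsSeminorm (hs := hs) (hp := hp)) a) (norm_nonneg _))
  rw [star_one, mul_one] at h1 h2
  calc _ ≤ _ := h1
    _ ≤ maxNorm a * ‖(show (gnsModule τ hs hp).Carrier from (1 : MonoidAlgebra ℂ G))‖ *
        ‖(show (gnsModule τ hs hp).Carrier from (1 : MonoidAlgebra ℂ G))‖ := by gcongr
    _ = _ := by rw [mul_assoc, h2, mul_comm]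

/-- A positive linear map from the group algebra into a commutative C*-algebra extends to the
group C*-algebra. -/
lemma exists_positive_extension {B : Type*} [CommCStarAlgebra B] [PartialOrder B]
    [StarOrderedRing B] (ρ : MonoidAlgebra ℂ G →ₗ[ℂ] B) (hs : ∀ a, ρ (star a) = star (ρ a))
    (hp : ∀ a, 0 ≤ ρ (a * star a)) :
    ∃ E : GroupCStar G →ₚ[ℂ] B, ∀ a, E (GroupCStar.of a) = ρ a := by
  have hb : ∀ a, ‖ρ a‖ ≤ ‖ρ 1‖ * ‖(GroupCStar.of (G := G)).toAlgHom.toLinearMap a‖ := fun a => by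
    -- The norm of `B` is the supremum over characters, and composing `ρ` with a character gives a
    -- positive functional; the scalar bound is thus uniform in the character.
    refine norm_le_of_char (by positivity) fun f => ?_
    refine (norm_positive_functional_le ((f : WeakDual ℂ B).toLinearMap ∘ₗ ρ) (fun a => ?_)
      (fun a => ?_) a).trans ?_
    · change f (ρ (star a)) = star (f (ρ a))
      rw [hs, map_star]
    · exact char_nonneg (hp a) f
    · have : ‖(GroupCStar.of (G := G)).toAlgHom.toLinearMap a‖ = maxNorm a :=
        GroupCStar.norm_ofAlg a
      rw [this]
      exact mul_le_mul_of_nonneg_right (norm_char_le (ρ 1) f) (maxNorm_nonneg a)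
  let E : GroupCStar G →L[ℂ] B := ρ.extendOfNorm (GroupCStar.of (G := G)).toAlgHom.toLinearMap
  have hE : ∀ a, E (GroupCStar.of a) = ρ a := fun a =>
    LinearMap.extendOfNorm_eq GroupCStar.denseRange_of ⟨_, hb⟩ a
  refine ⟨PositiveLinearMap.mk₀ E.toLinearMap fun x hx => ?_, hE⟩
  -- A positive element is `y* y`; approximating `y`, rather than `y* y`, from the group algebra
  -- keeps the approximants in the form on which `ρ` is known to be positive.
  obtain ⟨y, rfl⟩ := CStarAlgebra.nonneg_iff_eq_star_mul_self.1 hx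
  refine GroupCStar.induction (P := fun y => 0 ≤ E (star y * y)) ?_ (fun a => ?_) y
  · exact CStarAlgebra.isClosed_nonneg.preimage
      (E.continuous.comp (GroupCStar.continuous_star.mul continuous_id))
  · have := hp a
    rw [mul_comm, ← hE, map_mul, map_star] at this
    exact this

end PositiveFunctional

/-! ### The canonical trace and the conditional expectation onto a subgroup. -/

section Restriction

variable {G : Type*} [CommGroup G]

lemma star_mul_comm (a b : MonoidAlgebra ℂ G) : star (a * b) = star a * star b := by
  rw [star_mul, mul_comm]

/-- This sum of squared moduli gives both positivity and faithfulness of the trace on `ℂ[G]`. -/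
lemma coeff_one_mul_star_self (a : MonoidAlgebra ℂ G) :
    (a * star a).coeff 1 = a.coeff.sum fun _ z => z * star z := by
  rw [MonoidAlgebra.coeff_mul_apply_left]
  exact Finsupp.sum_congr fun g _ => by rw [coeff_star]; simp

lemma coeff_one_mul_star_self_nonneg (a : MonoidAlgebra ℂ G) : 0 ≤ (a * star a).coeff 1 := by
  rw [coeff_one_mul_star_self]
  exact Finset.sum_nonneg fun g _ => mul_star_self_nonneg _

/-- The canonical trace `∑ a_g λ_g ↦ a_1`. -/
lemma exists_trace : ∃ χ : GroupCStar G →ₚ[ℂ] ℂ,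
    ∀ a : MonoidAlgebra ℂ G, χ (GroupCStar.of a) = a.coeff 1 :=
  exists_positive_extension (G := G) (B := ℂ)
    { toFun := fun a : MonoidAlgebra ℂ G => a.coeff 1
      map_add' := fun _ _ => rfl
      map_smul' := fun _ _ => rfl }
    (fun a => by
      change (star a).coeff 1 = _
      rw [coeff_star, inv_one]; rfl)
    coeff_one_mul_star_self_nonneg

lemma eq_zero_of_coeff_one_mul_star_self {a : MonoidAlgebra ℂ G}
    (h : (a * star a).coeff 1 = 0) : a = 0 := by
  rw [coeff_one_mul_star_self, Finsupp.sum,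
    Finset.sum_eq_zero_iff_of_nonneg fun g _ => mul_star_self_nonneg _] at h
  ext g
  by_contra hg
  have := h g (Finsupp.mem_support_iff.2 hg)
  simp_all

variable (Γ : Subgroup G)

lemma coeff_restrictSubgroup (a : MonoidAlgebra ℂ G) (g : Γ) :
    (restrictSubgroup Γ a).coeff g = a.coeff g := rfl

/-- `restrictSubgroup` as a linear map. -/
def restrictₗ : MonoidAlgebra ℂ G →ₗ[ℂ] MonoidAlgebra ℂ Γ where
  toFun := restrictSubgroup Γ
  map_add' a b := by ext; simp [coeff_restrictSubgroup]
  map_smul' z a := by ext; simp [coeff_restrictSubgroup]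

lemma restrictₗ_apply (a : MonoidAlgebra ℂ G) : restrictₗ Γ a = restrictSubgroup Γ a := rfl

lemma restrictSubgroup_star (a : MonoidAlgebra ℂ G) :
    restrictSubgroup Γ (star a) = star (restrictSubgroup Γ a) := by
  ext g; simp [coeff_restrictSubgroup, coeff_star]

lemma restrictSubgroup_single_of_mem {g : G} (hg : g ∈ Γ) (z : ℂ) :
    restrictSubgroup Γ (MonoidAlgebra.single g z) = MonoidAlgebra.single ⟨g, hg⟩ z := by
  classical
  ext h
  rw [coeff_restrictSubgroup, MonoidAlgebra.coeff_single, MonoidAlgebra.coeff_single,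
    Finsupp.single_apply, Finsupp.single_apply]
  simp [Subtype.ext_iff]

lemma restrictSubgroup_single_of_notMem {g : G} (hg : g ∉ Γ) (z : ℂ) :
    restrictSubgroup Γ (MonoidAlgebra.single g z) = 0 := by
  classical
  ext h
  rw [coeff_restrictSubgroup, MonoidAlgebra.coeff_single, Finsupp.single_apply, if_neg]
  · rfl
  · rintro rfl; exact hg h.2

lemma includeSubgroup_single (g : Γ) (z : ℂ) :
    includeSubgroup Γ (MonoidAlgebra.single g z) = MonoidAlgebra.single (g : G) z := by
  simp [includeSubgroup]

lemma includeSubgroup_star (a : MonoidAlgebra ℂ Γ) :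
    includeSubgroup Γ (star a) = star (includeSubgroup Γ a) := by
  induction a using MonoidAlgebra.induction_linear with
  | zero => simp
  | add a b ha hb => simp only [star_add, map_add, ha, hb]
  | single g z => simp only [star_single, includeSubgroup_single, Subgroup.coe_inv]

/-- Translation by an element of `Γ` preserves `Γ` and its complement. This is the module property
of the conditional expectation that later moves scalars across the interior tensor product. -/
lemma restrictₗ_include_mul (a : MonoidAlgebra ℂ Γ) (b : MonoidAlgebra ℂ G) :
    restrictₗ Γ (includeSubgroup Γ a * b) = a * restrictₗ Γ b := by
  induction a using MonoidAlgebra.induction_linear with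
  | zero => simp
  | add a b ha hb => simp only [add_mul, map_add, ha, hb]
  | single g z =>
    ext h
    rw [includeSubgroup_single, restrictₗ_apply, coeff_restrictSubgroup,
      MonoidAlgebra.coeff_single_mul_apply, MonoidAlgebra.coeff_single_mul_apply]
    rfl

/-- The element of `Γ` by which `g` differs from the chosen representative of its coset. -/
def cosetPart (g : G) : Γ :=
  ⟨(QuotientGroup.mk g : G ⧸ Γ).out⁻¹ * g, QuotientGroup.eq.1 (QuotientGroup.out_eq' _)⟩

/-- The decomposition of `ℂ[G]` as a direct sum of copies of `ℂ[Γ]`, one for each coset. -/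
def cosetDecomp : MonoidAlgebra ℂ G →ₗ[ℂ] ((G ⧸ Γ) →₀ MonoidAlgebra ℂ Γ) :=
  (Finsupp.lsum ℂ fun g : G => Finsupp.lsingle (QuotientGroup.mk g : G ⧸ Γ) ∘ₗ
    MonoidAlgebra.lsingle (cosetPart Γ g)) ∘ₗ
    (MonoidAlgebra.coeffLinearEquiv ℂ : MonoidAlgebra ℂ G ≃ₗ[ℂ] _).toLinearMap

lemma cosetDecomp_single (g : G) (z : ℂ) : cosetDecomp Γ (MonoidAlgebra.single g z) =
    Finsupp.single (QuotientGroup.mk g) (MonoidAlgebra.single (cosetPart Γ g) z) := by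
  simp [cosetDecomp]

/-- On basis elements, `g h⁻¹` lies in `Γ` exactly when `g` and `h` share a coset, and then the
common representative `r` cancels: `(r⁻¹g)(r⁻¹h)⁻¹ = g h⁻¹`. For `b = a` the right side is a finite
sum of terms `y y*` in `ℂ[Γ]`, which is why the conditional expectation is positive. -/
lemma restrictₗ_mul_star (a b : MonoidAlgebra ℂ G) :
    restrictₗ Γ (a * star b) =
      (cosetDecomp Γ a).sum fun q x => x * star (cosetDecomp Γ b q) := by
  induction a using MonoidAlgebra.induction_linear with
  | zero => simp
  | add a a' ha ha' =>
    rw [add_mul, map_add, map_add, ha, ha', Finsupp.sum_add_index'] <;> simp [add_mul]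
  | single g z =>
    rw [cosetDecomp_single, Finsupp.sum_single_index (by simp)]
    induction b using MonoidAlgebra.induction_linear with
    | zero => simp
    | add b b' hb hb' =>
      rw [star_add, mul_add, map_add, map_add, Finsupp.add_apply, star_add, mul_add, hb, hb']
    | single h w =>
      classical
      rw [cosetDecomp_single, star_single, MonoidAlgebra.single_mul_single, Finsupp.single_apply,
        restrictₗ_apply]
      split_ifs with hq
      · have hm : g * h⁻¹ ∈ Γ := by
          have := QuotientGroup.eq.1 hq
          rwa [mul_comm] at this
        rw [star_single, MonoidAlgebra.single_mul_single, restrictSubgroup_single_of_mem Γ hm]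
        congr 1
        apply Subtype.ext
        simp only [cosetPart, Subgroup.coe_mul, Subgroup.coe_inv, hq]
        rw [mul_inv_rev, inv_inv, mul_mul_mul_comm, mul_comm _ (g * _), mul_assoc]
        simp [mul_comm]
      · have hm : g * h⁻¹ ∉ Γ := fun hm => hq (QuotientGroup.eq.2 (by rwa [mul_comm]))
        rw [restrictSubgroup_single_of_notMem Γ hm, star_zero, mul_zero]

/-- The canonical conditional expectation `∑ a_g λ_g ↦ ∑_{g ∈ Γ} a_g λ_g`. -/
lemma exists_conditionalExpectation : ∃ E : GroupCStar G →ₚ[ℂ] GroupCStar Γ,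
    ∀ a : MonoidAlgebra ℂ G, E (GroupCStar.of a) = GroupCStar.of (restrictSubgroup Γ a) :=
  exists_positive_extension ((GroupCStar.of (G := Γ)).toAlgHom.toLinearMap ∘ₗ restrictₗ Γ)
    (fun a => by
      change GroupCStar.of (restrictSubgroup Γ (star a)) = star (GroupCStar.of _)
      rw [restrictSubgroup_star, map_star]; rfl)
    (fun a => by
      change 0 ≤ GroupCStar.of (restrictₗ Γ (a * star a))
      rw [restrictₗ_mul_star, Finsupp.sum, map_sum]
      refine Finset.sum_nonneg fun q _ => ?_
      rw [map_mul, map_star]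
      exact mul_star_self_nonneg _)

end Restriction

/-! ### Extending form-preserving maps to isomorphisms of completions. -/

section Extension

/-- Two linear maps with dense ranges in complete spaces that induce the same norm on their common
domain differ by an isometric isomorphism. -/
lemma exists_linearIsometryEquiv {X E F : Type*} [AddCommGroup X] [Module ℂ X]
    [NormedAddCommGroup E] [NormedSpace ℂ E] [CompleteSpace E]
    [NormedAddCommGroup F] [NormedSpace ℂ F] [CompleteSpace F]
    (u : X →ₗ[ℂ] E) (v : X →ₗ[ℂ] F) (hu : DenseRange u) (hv : DenseRange v)
    (h : ∀ x, ‖v x‖ = ‖u x‖) : ∃ U : E ≃ₗᵢ[ℂ] F, ∀ x, U (u x) = v x :=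
  ⟨(LinearEquiv.refl ℂ X).extendOfIsometry u v hu hv h,
    fun x => LinearEquiv.extendOfIsometry_eq _ u v hu hv h x⟩

variable {A A' B X Y : Type*} [Ring A] [Algebra ℂ A] [Ring A'] [Algebra ℂ A'] [CommCStarAlgebra B]
  [PartialOrder B] [StarOrderedRing B] [AddCommGroup X] [Module ℂ X] [AddCommGroup Y] [Module ℂ Y]

lemma PreHilbertModule.inner_actCompl (P : PreHilbertModule A B X) (b : B) (x y : P.Compl) :
    (inner B y (P.actCompl b x) : B) = b * inner B y x :=
  CStarModule.inner_op_smul_right (A := B) (E := P.Compl) (a := b) (x := y) (y := x)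

/-- A form-preserving linear map with dense range from a pre-Hilbert module into the completion of
another one extends to an isomorphism of Hilbert modules. -/
lemma PreHilbertModule.exists_unitary (P : PreHilbertModule A B X) (Q : PreHilbertModule A' B Y)
    (v : X →ₗ[ℂ] Q.Compl) (hv : DenseRange v)
    (h : ∀ x y, inner B (v x) (v y) = P.form y x) :
    ∃ W : P.Compl ≃ₗᵢ[ℂ] Q.Compl,
      (∀ (b : B) (x : P.Compl), W (P.actCompl b x) = Q.actCompl b (W x)) ∧
      (∀ x y : P.Compl, inner B (W x) (W y) = (inner B x y : B)) ∧
      ∀ x, W (P.toCompl x) = v x := by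
  obtain ⟨W, hW⟩ := exists_linearIsometryEquiv P.toCompl v P.denseRange_toCompl hv fun x => by
    rw [P.norm_toCompl, Q.norm_eq_compl, h]
  have hi : ∀ x y : P.Compl, inner B (W x) (W y) = (inner B x y : B) := fun x y => by
    refine P.induction₂ (p := fun x y => inner B (W x) (W y) = (inner B x y : B))
      (isClosed_eq ?_ ?_) (fun x y => ?_) x y
    · simp only [inner_eq]; fun_prop
    · simp only [inner_eq]; fun_prop
    · rw [hW, hW, h, inner_toCompl]
  refine ⟨W, fun b x => ?_, hi, hW⟩
  -- `B`-linearity is automatic: `W` is surjective and preserves inner products, so the defect is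
  -- orthogonal to everything, in particular to itself.
  have hz : ∀ z : Q.Compl, (inner B z (W (P.actCompl b x) - Q.actCompl b (W x)) : B) = 0 :=
    fun z => by
      obtain ⟨y, rfl⟩ := W.surjective z
      rw [inner_eq, map_sub, ← inner_eq, ← inner_eq, hi, P.inner_actCompl,
        Q.inner_actCompl, hi, sub_self]
  exact sub_eq_zero.1 ((CStarModule.inner_self (A := B)).1 (hz _))

end Extension

/-! ### Identities and density in interior tensor products. -/

section InteriorDensity

variable {A M C : Type*} [CommCStarAlgebra A] [PartialOrder A] [StarOrderedRing A]
  [NormedAddCommGroup M] [NormedSpace ℂ M] [Module A M] [CStarModule A M]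
  [CommCStarAlgebra C] [PartialOrder C] [StarOrderedRing C]

lemma inner_interiorTensor_tmul (E : A →ₚ[ℂ] C) (x y : M) (a b : C) :
    inner C ((interiorTensor M E).toCompl (y ⊗ₜ b)) ((interiorTensor M E).toCompl (x ⊗ₜ a))
      = a * star b * E (inner A y x) :=
  (interiorTensor M E).inner_toCompl _ _

/-- The inner square of the difference expands into four terms, which the hypotheses cancel in
pairs; the completion has no nonzero null vectors. -/
lemma interiorTensor_toCompl_eq {E : A →ₚ[ℂ] C} {x y : M} {a b : C}
    (h₁ : a * star a * E (inner A x x) = a * star b * E (inner A y x))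
    (h₂ : b * star a * E (inner A x y) = b * star b * E (inner A y y)) :
    (interiorTensor M E).toCompl (x ⊗ₜ a) = (interiorTensor M E).toCompl (y ⊗ₜ b) := by
  rw [← sub_eq_zero, ← CStarModule.inner_self (A := C)]
  rw [CStarModule.inner_sub_left, CStarModule.inner_sub_right, CStarModule.inner_sub_right]
  simp only [inner_interiorTensor_tmul, h₁, h₂]
  ring

/-- The map `(x, a) ↦ x ⊗ a` into the completed interior tensor product. -/
def interiorTmul (E : A →ₚ[ℂ] C) : M →ₗ[ℂ] C →ₗ[ℂ] (interiorTensor M E).Compl :=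
  (TensorProduct.mk ℂ M C).compr₂ (interiorTensor M E).toCompl

/-- A positive map is bounded, so `‖x ⊗ a‖² = ‖a a* E⟨x, x⟩‖ ≤ K ‖a‖² ‖x‖²`. The resulting joint
continuity is what the density argument needs. -/
lemma exists_norm_interiorTmul_le (E : A →ₚ[ℂ] C) :
    ∃ K : ℝ, ∀ (x : M) (a : C), ‖interiorTmul E x a‖ ≤ K * ‖x‖ * ‖a‖ := by
  obtain ⟨K, hK⟩ := E.exists_norm_apply_le
  refine ⟨√K, fun x a => ?_⟩
  rw [(interiorTensor M E).norm_eq_compl]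
  refine Real.sqrt_le_iff.2 ⟨by positivity, ?_⟩
  have e : (inner C (interiorTmul E x a) (interiorTmul E x a) : C)
      = a * star a * E (inner A x x) := inner_interiorTensor_tmul E x x a a
  have hn : ‖(inner A x x : A)‖ = ‖x‖ ^ 2 := (CStarModule.norm_sq_eq (A := A)).symm
  rw [e, mul_pow, mul_pow, Real.sq_sqrt K.coe_nonneg]
  calc ‖a * star a * E (inner A x x)‖ ≤ ‖a‖ * ‖star a‖ * ‖E (inner A x x)‖ :=
        (norm_mul_le _ _).trans (mul_le_mul_of_nonneg_right (norm_mul_le _ _) (norm_nonneg _))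
    _ ≤ ‖a‖ * ‖a‖ * (K * ‖(inner A x x : A)‖) := by
        rw [norm_star]; exact mul_le_mul_of_nonneg_left (hK _) (by positivity)
    _ = _ := by rw [hn]; ring

/-- If the tensors `x ⊗ a` with `x` and `a` in dense sets are of the form `x' ⊗ 1`, then the tensors
`x ⊗ 1` with `x` in the dense set are dense. -/
lemma denseRange_interiorTmul_one {X Y : Type*} [AddCommGroup X] [Module ℂ X] (E : A →ₚ[ℂ] C)
    (u : X →ₗ[ℂ] M) (hu : DenseRange u) (d : Y → C) (hd : DenseRange d) (s : Y → X → X)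
    (h : ∀ y x, interiorTmul E (u x) (d y) = interiorTmul E (u (s y x)) 1) :
    DenseRange ((interiorTmul E).flip 1 ∘ₗ u) := by
  obtain ⟨K, hK⟩ := exists_norm_interiorTmul_le (M := M) E
  have hc : Continuous fun p : M × C => interiorTmul E p.1 p.2 := by
    have : Continuous fun p : M × C => (interiorTmul E).mkContinuous₂ K hK p.1 p.2 := by fun_prop
    exact this
  let N := (LinearMap.range ((interiorTmul E).flip 1 ∘ₗ u)).topologicalClosure
  have hN : IsClosed (N : Set (interiorTensor M E).Compl) :=
    Submodule.isClosed_topologicalClosure _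
  -- By joint continuity it suffices to take `x` and `a` in the dense sets, where `h` rewrites the
  -- tensor as one of the form `x' ⊗ 1`.
  have h1 : ∀ x a, interiorTmul E x a ∈ N := fun x a => by
    refine (hu.prodMap hd).induction_on (p := fun q : M × C => interiorTmul E q.1 q.2 ∈ N) (x, a)
      (hN.preimage hc) fun q => ?_
    refine Submodule.le_topologicalClosure _ ⟨s q.2 q.1, ?_⟩
    exact (h q.2 q.1).symm
  have h2 : ∀ t, (interiorTensor M E).toCompl t ∈ N := fun t => by
    induction t using TensorProduct.induction_on with
    | zero => rw [map_zero]; exact N.zero_mem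
    | add t t' ht ht' => rw [map_add]; exact N.add_mem ht ht'
    | tmul x a => exact h1 x a
  intro z
  have hz : z ∈ N := (interiorTensor M E).denseRange_toCompl.induction_on z hN h2
  rwa [← SetLike.mem_coe, Submodule.topologicalClosure_coe, LinearMap.coe_range] at hz

end InteriorDensity

/-! ### Generalised products `φ`, and coordinates from `ℂ^{⊗I}` to `ℂ[Ω]`. -/

section CircleProducts

open PiTensorProduct Filter Function

variable {I : Type*}

/-- The circle is divisible: an `n`-th root of `z` is the exponential of `arg z / n`. Division by
zero yields `exp 0 = 1`, as `div_zero` requires. -/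
lemma circle_baer : Module.Baer ℤ (Additive Circle) := by
  let : DivisibleBy (Additive Circle) ℤ :=
    { div := fun z n => .ofMul (Circle.exp (Complex.arg (z.toMul : ℂ) / n))
      div_zero := fun z => by simp
      div_cancel := fun {n} z hn => by
        have hn' : (n : ℝ) ≠ 0 := by exact_mod_cast hn
        rw [← ofMul_zpow, ← Circle.exp_zsmul, zsmul_eq_mul, mul_div_cancel₀ _ hn', Circle.exp_arg]
        rfl }
  exact Module.Baer.of_divisible _

/-- Homomorphisms that extend the product of the families that are equal to `1` e.f. exist. -/
lemma nonempty_circleProd : Nonempty (CircleProd I) := by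
  let p : finCircle I →* Circle :=
    { toFun := fun α => ∏ᶠ i, (α : I → Circle) i
      map_one' := by simp
      map_mul' := fun α β => finprod_mul_distrib α.2 β.2 }
  -- Injectivity of the circle extends the finite product from the subgroup of families equal to `1`
  -- e.f. to all families.
  obtain ⟨q, hq⟩ := circle_baer.extension_property_addMonoidHom
    (MonoidHom.toAdditive (finCircle I).subtype)
    (fun _ _ h => Subtype.ext h) (MonoidHom.toAdditive p)
  exact ⟨⟨MonoidHom.toAdditive.symm q, fun α hα => DFunLike.congr_fun hq ⟨α, hα⟩⟩⟩

lemma tprod_smul_eq {M : I → Type*} [∀ i, AddCommGroup (M i)] [∀ i, Module ℂ (M i)]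
    (z : I → ℂ) (hz : AgreeEF z 1) (x : Π i, M i) :
    tprod ℂ (fun i => z i • x i) = (∏ᶠ i, z i) • tprod ℂ x := by
  classical
  have hs : (mulSupport z).Finite := hz
  have h := (tprod ℂ : MultilinearMap ℂ M (⨂[ℂ] i, M i)).map_piecewise_smul z x hs.toFinset
  rw [finprod_eq_prod_of_mulSupport_subset (s := hs.toFinset) z (by simp), ← h]
  congr 1
  funext i
  by_cases hi : i ∈ hs.toFinset
  · simp [hi]
  · have : z i = 1 := by simpa using hi
    simp [this]

/-- The quotients `β_i / α_i` are `1` e.f., so multilinearity pulls out their product. -/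
lemma tprod_eq_of_agree {β : I → ℂ} {α : I → Circle} (h : AgreeEF β fun i => (α i : ℂ)) :
    tprod ℂ β = (∏ᶠ i, β i * (α i : ℂ)⁻¹) • tprod ℂ fun i => (α i : ℂ) := by
  rw [← tprod_smul_eq]
  · congr 1
    funext i
    simp
  · filter_upwards [h] with i hi
    simp [hi]

lemma phiOne_tprod_of_agree {β : I → ℂ} (h : AgreeEF β 1) : phiOne I (tprod ℂ β) = ∏ᶠ i, β i := by
  rw [phiOne, lift.tprod]
  exact if_pos h

lemma phiOne_tprod_of_not {β : I → ℂ} (h : ¬ AgreeEF β 1) : phiOne I (tprod ℂ β) = 0 := by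
  rw [phiOne, lift.tprod]
  exact if_neg h

lemma truncation_tprod_of_agree {G : Subgroup (OmegaUt I)} {β : I → ℂ}
    (h : ∃ α : I → Circle, (QuotientGroup.mk α : OmegaUt I) ∈ G ∧ AgreeEF β fun i => (α i : ℂ)) :
    truncation G (tprod ℂ β) = tprod ℂ β := by
  rw [truncation, lift.tprod]
  exact if_pos h

lemma truncation_tprod_of_not {G : Subgroup (OmegaUt I)} {β : I → ℂ}
    (h : ¬ ∃ α : I → Circle, (QuotientGroup.mk α : OmegaUt I) ∈ G ∧ AgreeEF β fun i => (α i : ℂ)) :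
    truncation G (tprod ℂ β) = 0 := by
  rw [truncation, lift.tprod]
  exact if_neg h

lemma agreeEF_coe_one_iff (α : I → Circle) :
    AgreeEF (fun i => (α i : ℂ)) 1 ↔ (QuotientGroup.mk α : OmegaUt I) = 1 := by
  rw [QuotientGroup.eq_one_iff]
  exact eventually_congr (Eventually.of_forall fun i => Circle.coe_eq_one)

lemma mk_eq_mk_of_agree {β : I → ℂ} {α γ : I → Circle} (h : AgreeEF β fun i => (α i : ℂ))
    (h' : AgreeEF β fun i => (γ i : ℂ)) :
    (QuotientGroup.mk α : OmegaUt I) = QuotientGroup.mk γ := by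
  refine QuotientGroup.eq.2 ?_
  change AgreeEF (α⁻¹ * γ) 1
  filter_upwards [h, h'] with i hi hi'
  have : α i = γ i := Circle.coe_injective (hi.symm.trans hi')
  simp [this]

lemma cTensor_smul_mul (r : ℂ) (k l : CTensor I) : (r • k) * l = r • (k * l) := by
  rw [mul_def, mul_def, map_smul, LinearMap.smul_apply]

lemma cTensor_mul_smul (r : ℂ) (k l : CTensor I) : k * (r • l) = r • (k * l) := by
  rw [mul_def, mul_def, map_smul]

variable (φ : CircleProd I)

lemma omegaAlg_single (α : I → Circle) (z : ℂ) :
    omegaAlg φ (MonoidAlgebra.single (QuotientGroup.mk α) z)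
      = (z * (φ.toHom α : ℂ)⁻¹) • tprod ℂ fun i => (α i : ℂ) := by
  rw [omegaAlg, MonoidAlgebra.lift_single, mul_smul]
  rfl

lemma phiOne_omegaAlg (a : MonoidAlgebra ℂ (OmegaUt I)) :
    phiOne I (omegaAlg φ a) = a.coeff 1 := by
  classical
  induction a using MonoidAlgebra.induction_linear with
  | zero => simp
  | add a b ha hb => rw [map_add, map_add, ha, hb]; rfl
  | single g z =>
    obtain ⟨α, rfl⟩ := QuotientGroup.mk_surjective g
    rw [omegaAlg_single, map_smul, MonoidAlgebra.coeff_single, Finsupp.single_apply]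
    split_ifs with h
    · have h' := (agreeEF_coe_one_iff α).2 h
      have h1 : AgreeEF α 1 := (QuotientGroup.eq_one_iff α).1 h
      have e : ((∏ᶠ i, α i : Circle) : ℂ) = ∏ᶠ i, (α i : ℂ) :=
        Circle.coeHom.map_finprod (f := α) h1
      rw [phiOne_tprod_of_agree h', φ.map_fin α h1, ← e, smul_eq_mul, mul_assoc,
        inv_mul_cancel₀ (Circle.coe_ne_zero _), mul_one]
    · rw [phiOne_tprod_of_not fun h' => h ((agreeEF_coe_one_iff α).1 h'), smul_zero]

/-- The coefficient of `a` at `g` is `φ₁(Ψ(λ_{g⁻¹}) Ψ(a))`, hence is determined by `Ψ(a)`. -/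
lemma omegaAlg_injective : Injective (omegaAlg φ) := by
  refine (injective_iff_map_eq_zero _).2 fun a ha => ?_
  ext g
  have h := phiOne_omegaAlg φ (MonoidAlgebra.single g⁻¹ 1 * a)
  rw [map_mul, ha, mul_zero, map_zero, MonoidAlgebra.coeff_single_mul_apply] at h
  simpa using h.symm

lemma exists_omegaAlg_leftInverse :
    ∃ D : CTensor I →ₗ[ℂ] MonoidAlgebra ℂ (OmegaUt I), ∀ a, D (omegaAlg φ a) = a := by
  obtain ⟨D, hD⟩ := (omegaAlg φ).toLinearMap.exists_leftInverse_of_injective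
    (LinearMap.ker_eq_bot.2 (omegaAlg_injective φ))
  exact ⟨D, fun a => LinearMap.congr_fun hD a⟩

/-- The truncation of an element of `ℂ^{⊗I}` to the span of the tensors of families of complex
numbers of modulus one, as an element of `ℂ[Ω]`. -/
def omegaCoord : CTensor I →ₗ[ℂ] MonoidAlgebra ℂ (OmegaUt I) :=
  (exists_omegaAlg_leftInverse φ).choose ∘ₗ truncation ⊤

/-- The left inverse in `omegaCoord` is arbitrary off the range of `Ψ`, but `truncation ⊤` lands in
that range. The factor `φ(α)` undoes the normalisation `φ(α)⁻¹` in `Ψ(λ_{[α]})`. -/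
lemma omegaCoord_tprod {β : I → ℂ} {α : I → Circle} (h : AgreeEF β fun i => (α i : ℂ)) :
    omegaCoord φ (tprod ℂ β) = MonoidAlgebra.single (QuotientGroup.mk α)
      ((∏ᶠ i, β i * (α i : ℂ)⁻¹) * φ.toHom α) := by
  rw [← (exists_omegaAlg_leftInverse φ).choose_spec (MonoidAlgebra.single _ _), omegaAlg_single,
    mul_assoc, mul_inv_cancel₀ (Circle.coe_ne_zero _), mul_one, ← tprod_eq_of_agree h, omegaCoord,
    LinearMap.comp_apply, truncation_tprod_of_agree ⟨α, Subgroup.mem_top _, h⟩]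

lemma omegaCoord_tprod_of_not {β : I → ℂ}
    (h : ¬ ∃ α : I → Circle, AgreeEF β fun i => (α i : ℂ)) : omegaCoord φ (tprod ℂ β) = 0 := by
  rw [omegaCoord, LinearMap.comp_apply, truncation_tprod_of_not, map_zero]
  rintro ⟨α, -, hα⟩
  exact h ⟨α, hα⟩

/-- An elementary tensor that agrees e.f. with a circle family determines the class of that family,
so truncating to `G` and restricting coefficients to `G` keep the same tensors. -/
lemma omegaAlg_restrict_omegaCoord (G : Subgroup (OmegaUt I)) (k : CTensor I) :
    omegaAlg φ (includeSubgroup G (restrictₗ G (omegaCoord φ k))) = truncation G k := by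
  induction k using PiTensorProduct.induction_on with
  | add k l hk hl => simp only [map_add, hk, hl]
  | smul_tprod r β =>
    simp only [map_smul]
    congr 1
    by_cases h : ∃ α : I → Circle, AgreeEF β fun i => (α i : ℂ)
    · obtain ⟨α, hα⟩ := h
      rw [omegaCoord_tprod φ hα, restrictₗ_apply]
      by_cases hG : (QuotientGroup.mk α : OmegaUt I) ∈ G
      · rw [restrictSubgroup_single_of_mem G hG, includeSubgroup_single, omegaAlg_single, mul_assoc,
          mul_inv_cancel₀ (Circle.coe_ne_zero _), mul_one, ← tprod_eq_of_agree hα,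
          truncation_tprod_of_agree ⟨α, hG, hα⟩]
      · rw [restrictSubgroup_single_of_notMem G hG, map_zero, map_zero, truncation_tprod_of_not]
        rintro ⟨γ, hγ, hγ'⟩
        exact hG (mk_eq_mk_of_agree hα hγ' ▸ hγ)
    · rw [omegaCoord_tprod_of_not φ h, truncation_tprod_of_not]
      · simp
      · rintro ⟨α, -, hα⟩
        exact h ⟨α, hα⟩

lemma omegaAlg_omegaCoord (k : CTensor I) : omegaAlg φ (omegaCoord φ k) = truncation ⊤ k := by
  rw [← omegaAlg_restrict_omegaCoord φ]
  congr 1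
  generalize omegaCoord φ k = a
  induction a using MonoidAlgebra.induction_linear with
  | zero => simp
  | add a b ha hb => rw [map_add, map_add, ← ha, ← hb]
  | single g z =>
    rw [restrictₗ_apply, restrictSubgroup_single_of_mem ⊤ (Subgroup.mem_top g),
      includeSubgroup_single]

/-- The elementary tensors killed by `truncation ⊤` are also killed by `φ₁`, because a family equal
to `1` e.f. agrees with a circle family. -/
lemma omegaCoord_coeff_one (k : CTensor I) : (omegaCoord φ k).coeff 1 = phiOne I k := by
  rw [← phiOne_omegaAlg φ, omegaAlg_omegaCoord]
  induction k using PiTensorProduct.induction_on with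
  | add k l hk hl => simp only [map_add, hk, hl]
  | smul_tprod r β =>
    simp only [map_smul]
    congr 1
    by_cases h : ∃ α : I → Circle,
      (QuotientGroup.mk α : OmegaUt I) ∈ (⊤ : Subgroup (OmegaUt I)) ∧ AgreeEF β fun i => (α i : ℂ)
    · rw [truncation_tprod_of_agree h]
    · rw [truncation_tprod_of_not h, phiOne_tprod_of_not, map_zero]
      intro h1
      refine h ⟨1, Subgroup.mem_top _, ?_⟩
      filter_upwards [h1] with i hi
      simpa using hi

/-- Multiplying by a circle family `γ` permutes the e.f. classes of circle families and leaves the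
quotients `β_i / α_i` unchanged; the scalars match because `φ` is multiplicative. -/
lemma omegaCoord_omegaAlg_mul (a : MonoidAlgebra ℂ (OmegaUt I)) (k : CTensor I) :
    omegaCoord φ (omegaAlg φ a * k) = a * omegaCoord φ k := by
  induction a using MonoidAlgebra.induction_linear with
  | zero => simp
  | add a b ha hb => simp only [map_add, add_mul, ha, hb]
  | single g z =>
    obtain ⟨γ, rfl⟩ := QuotientGroup.mk_surjective g
    induction k using PiTensorProduct.induction_on with
    | add k l hk hl => simp only [map_add, mul_add, hk, hl]
    | smul_tprod r β =>
      rw [cTensor_mul_smul, map_smul, map_smul, mul_smul_comm]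
      congr 1
      rw [omegaAlg_single, cTensor_smul_mul, tprod_mul_tprod, map_smul]
      by_cases h : ∃ α : I → Circle, AgreeEF β fun i => (α i : ℂ)
      · obtain ⟨α, hα⟩ := h
        have h' : AgreeEF ((fun i => (γ i : ℂ)) * β) fun i => ((γ * α) i : ℂ) := by
          filter_upwards [hα] with i hi
          simp [hi]
        rw [omegaCoord_tprod φ hα, omegaCoord_tprod φ h', MonoidAlgebra.single_mul_single,
          MonoidAlgebra.smul_single, QuotientGroup.mk_mul]
        congr 1
        have e : ∀ i, ((fun i => (γ i : ℂ)) * β) i * ((γ * α) i : ℂ)⁻¹ = β i * (α i : ℂ)⁻¹ :=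
          fun i => by
            have := Circle.coe_ne_zero (γ i)
            have := Circle.coe_ne_zero (α i)
            simp only [Pi.mul_apply, Circle.coe_mul]
            field_simp
        have hφ := Circle.coe_ne_zero (φ.toHom γ)
        rw [finprod_congr e, map_mul, Circle.coe_mul, smul_eq_mul]
        field_simp
      · rw [omegaCoord_tprod_of_not φ h, omegaCoord_tprod_of_not φ, smul_zero, mul_zero]
        rintro ⟨α, hα⟩
        refine h ⟨γ⁻¹ * α, ?_⟩
        filter_upwards [hα] with i hi
        have := Circle.coe_ne_zero (γ i)
        simp only [Pi.mul_apply, Pi.inv_apply, Circle.coe_mul, Circle.coe_inv] at hi ⊢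
        rw [← hi]
        field_simp

/-- Conjugation inverts circle families, matching `λ_g* = λ_{g⁻¹}` on the group algebra, and
`φ(α⁻¹)` is the conjugate of `φ(α)`. -/
lemma star_omegaCoord_tprod (β : I → ℂ) :
    star (omegaCoord φ (tprod ℂ β)) = omegaCoord φ (tprod ℂ fun i => star (β i)) := by
  by_cases h : ∃ α : I → Circle, AgreeEF β fun i => (α i : ℂ)
  · obtain ⟨α, hα⟩ := h
    have h' : AgreeEF (fun i => star (β i)) fun i => (α⁻¹ i : ℂ) := by
      filter_upwards [hα] with i hi
      rw [hi, Pi.inv_apply, Circle.coe_inv_eq_conj]; rfl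
    have hf : (mulSupport fun i => β i * (α i : ℂ)⁻¹).Finite := by
      have : AgreeEF (fun i => β i * (α i : ℂ)⁻¹) 1 := by
        filter_upwards [hα] with i hi
        simp [hi]
      exact this
    rw [omegaCoord_tprod φ hα, omegaCoord_tprod φ h', star_single, star_mul', QuotientGroup.mk_inv]
    congr 2
    · refine ((starRingEnd ℂ).toMonoidHom.map_finprod hf).trans (finprod_congr fun i => ?_)
      change starRingEnd ℂ (β i * (α i : ℂ)⁻¹) = starRingEnd ℂ (β i) * ((α i)⁻¹ : Circle)⁻¹
      have hc : starRingEnd ℂ (α i : ℂ) = ((α i)⁻¹ : Circle) := (Circle.coe_inv_eq_conj _).symm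
      rw [map_mul, map_inv₀, hc, Circle.coe_inv (α i)⁻¹]
    · rw [map_inv, Circle.coe_inv_eq_conj]; rfl
  · rw [omegaCoord_tprod_of_not φ h, omegaCoord_tprod_of_not φ]
    · exact star_zero (MonoidAlgebra ℂ (OmegaUt I))
    rintro ⟨α, hα⟩
    refine h ⟨α⁻¹, ?_⟩
    filter_upwards [hα] with i hi
    rw [Pi.inv_apply, Circle.coe_inv_eq_conj, ← hi, starRingEnd_apply, star_star]

end CircleProducts

/-! ### The `ℂ[Ω]`-valued form and the action on `⊗ H_i`. -/

section TensorForm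

open PiTensorProduct Filter Function

variable {I : Type*} (H : I → Type*) [∀ i, NormedAddCommGroup (H i)]
  [∀ i, InnerProductSpace ℂ (H i)]

lemma tensorForm_add_left (ξ ξ' η : ⨂[ℂ] i, H i) :
    tensorForm H (ξ + ξ') η = tensorForm H ξ η + tensorForm H ξ' η :=
  map_add _ _ _

lemma tensorForm_smul_left (z : ℂ) (ξ η : ⨂[ℂ] i, H i) :
    tensorForm H (z • ξ) η = z • tensorForm H ξ η :=
  map_smul _ _ _

lemma tensorForm_add_right (ξ η η' : ⨂[ℂ] i, H i) :
    tensorForm H ξ (η + η') = tensorForm H ξ η + tensorForm H ξ η' := by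
  unfold tensorForm
  rw [map_add]; rfl

/-- The second variable is built by an additive lift, so conjugate linearity there is read off the
coefficient of an elementary tensor; with additivity this suffices for inductions on tensors. -/
lemma tensorForm_smul_tprod_right (z : ℂ) (ξ : ⨂[ℂ] i, H i) (y : Π i, H i) :
    tensorForm H ξ (z • tprod ℂ y) = starRingEnd ℂ z • tensorForm H ξ (tprod ℂ y) := by
  have h : ∀ w : ℂ, tensorForm H ξ (tprodCoeff ℂ w y) = starRingEnd ℂ w • formLeft H y ξ :=
    fun w => rfl
  rw [← tprodCoeff_eq_smul_tprod, h, tprod_eq_tprodCoeff_one]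
  change _ = starRingEnd ℂ z • tensorForm H ξ (tprodCoeff ℂ 1 y)
  rw [h, map_one, one_smul]

lemma tensorForm_tensorAct (k : CTensor I) (ξ η : ⨂[ℂ] i, H i) :
    tensorForm H (tensorAct H k ξ) η = k * tensorForm H ξ η := by
  induction k using PiTensorProduct.induction_on with
  | add k l hk hl =>
    rw [map_add, LinearMap.add_apply, tensorForm_add_left, hk, hl, add_mul]
  | smul_tprod r β =>
    rw [map_smul, LinearMap.smul_apply, tensorForm_smul_left, cTensor_smul_mul]
    congr 1
    induction ξ using PiTensorProduct.induction_on with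
    | add ξ ξ' hξ hξ' => rw [map_add, tensorForm_add_left, tensorForm_add_left, hξ, hξ', mul_add]
    | smul_tprod s x =>
      rw [map_smul, tensorForm_smul_left, tensorForm_smul_left, cTensor_mul_smul]
      congr 1
      induction η using PiTensorProduct.induction_on with
      | add η η' hη hη' => rw [tensorForm_add_right, tensorForm_add_right, hη, hη', mul_add]
      | smul_tprod t y =>
        rw [tensorForm_smul_tprod_right, tensorForm_smul_tprod_right, cTensor_mul_smul,
          tensorAct_tprod, tensorForm_tprod, tensorForm_tprod, tprod_mul_tprod]
        congr 2
        funext i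
        rw [inner_smul_right]; rfl

lemma tensorAct_mul (k l : CTensor I) (ξ : ⨂[ℂ] i, H i) :
    tensorAct H (k * l) ξ = tensorAct H k (tensorAct H l ξ) := by
  induction k using PiTensorProduct.induction_on with
  | add k k' hk hk' =>
    rw [add_mul, map_add, map_add, LinearMap.add_apply, LinearMap.add_apply, hk, hk']
  | smul_tprod r β =>
    rw [cTensor_smul_mul, map_smul, map_smul, LinearMap.smul_apply, LinearMap.smul_apply]
    congr 1
    induction l using PiTensorProduct.induction_on with
    | add l l' hl hl' =>
      rw [mul_add, map_add, map_add, LinearMap.add_apply, LinearMap.add_apply, map_add, hl, hl']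
    | smul_tprod s γ =>
      rw [cTensor_mul_smul, map_smul, map_smul, LinearMap.smul_apply, LinearMap.smul_apply,
        map_smul]
      congr 1
      induction ξ using PiTensorProduct.induction_on with
      | add ξ ξ' hξ hξ' => simp only [map_add, hξ, hξ']
      | smul_tprod t x =>
        simp only [map_smul, tprod_mul_tprod, tensorAct_tprod]
        congr 2
        funext i
        exact mul_smul _ _ _

lemma tensorAct_one (ξ : ⨂[ℂ] i, H i) : tensorAct H 1 ξ = ξ := by
  rw [one_def]
  induction ξ using PiTensorProduct.induction_on with
  | add ξ ξ' hξ hξ' => rw [map_add, hξ, hξ']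
  | smul_tprod t x =>
    rw [map_smul, tensorAct_tprod]
    simp

variable {H} in
lemma tprod_mem_unTensor {x : Π i, H i} (hx : ∀ i, ‖x i‖ = 1) : tprod ℂ x ∈ unTensor H :=
  Submodule.subset_span ⟨x, hx, rfl⟩

lemma tensorAct_omegaAlg_mem (φ : CircleProd I) (a : MonoidAlgebra ℂ (OmegaUt I))
    {ξ : ⨂[ℂ] i, H i} (hξ : ξ ∈ unTensor H) : tensorAct H (omegaAlg φ a) ξ ∈ unTensor H := by
  induction a using MonoidAlgebra.induction_linear with
  | zero => rw [map_zero, map_zero]; exact Submodule.zero_mem _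
  | add a b ha hb => rw [map_add, map_add]; exact Submodule.add_mem _ ha hb
  | single g z =>
    obtain ⟨γ, rfl⟩ := QuotientGroup.mk_surjective g
    rw [omegaAlg_single, map_smul]
    refine Submodule.smul_mem _ _ ?_
    induction hξ using Submodule.span_induction with
    | mem ξ h =>
      obtain ⟨x, hx, rfl⟩ := h
      rw [tensorAct_tprod]
      exact tprod_mem_unTensor fun i => by rw [norm_smul, hx, Circle.norm_coe, one_mul]
    | zero => rw [map_zero]; exact Submodule.zero_mem _
    | add ξ η _ _ h h' => rw [map_add]; exact Submodule.add_mem _ h h'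
    | smul t ξ _ h => rw [map_smul]; exact Submodule.smul_mem _ _ h

variable (φ : CircleProd I)

/-- The `ℂ[Ω]`-valued form on `⊗ H_i`. -/
def omegaForm (ξ η : ⨂[ℂ] i, H i) : MonoidAlgebra ℂ (OmegaUt I) :=
  omegaCoord φ (tensorForm H ξ η)

lemma omegaForm_add_left (ξ ξ' η : ⨂[ℂ] i, H i) :
    omegaForm H φ (ξ + ξ') η = omegaForm H φ ξ η + omegaForm H φ ξ' η := by
  rw [omegaForm, tensorForm_add_left, map_add]; rfl

lemma omegaForm_act_left (a : MonoidAlgebra ℂ (OmegaUt I)) (ξ η : ⨂[ℂ] i, H i) :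
    omegaForm H φ (tensorAct H (omegaAlg φ a) ξ) η = a * omegaForm H φ ξ η := by
  rw [omegaForm, tensorForm_tensorAct, omegaCoord_omegaAlg_mul]; rfl

lemma star_omegaForm (ξ η : ⨂[ℂ] i, H i) :
    star (omegaForm H φ ξ η) = omegaForm H φ η ξ := by
  unfold omegaForm
  induction ξ using PiTensorProduct.induction_on with
  | add ξ ξ' hξ hξ' =>
    rw [tensorForm_add_left, tensorForm_add_right, map_add, map_add, star_add', hξ, hξ']
  | smul_tprod s x =>
    rw [tensorForm_smul_left, tensorForm_smul_tprod_right, map_smul, map_smul, star_smul]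
    congr 1
    induction η using PiTensorProduct.induction_on with
    | add η η' hη hη' =>
      rw [tensorForm_add_left, tensorForm_add_right, map_add, map_add, star_add', hη, hη']
    | smul_tprod t y =>
      rw [tensorForm_smul_left, tensorForm_smul_tprod_right, map_smul, map_smul, star_smul,
        ← starRingEnd_apply, Complex.conj_conj]
      congr 1
      rw [tensorForm_tprod, tensorForm_tprod, star_omegaCoord_tprod]
      congr 2
      funext i
      exact inner_conj_symm _ _

lemma omegaForm_add_right (ξ η η' : ⨂[ℂ] i, H i) :
    omegaForm H φ ξ (η + η') = omegaForm H φ ξ η + omegaForm H φ ξ η' := by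
  rw [omegaForm, tensorForm_add_right, map_add]; rfl

lemma omegaForm_act_right (a : MonoidAlgebra ℂ (OmegaUt I)) (ξ η : ⨂[ℂ] i, H i) :
    omegaForm H φ ξ (tensorAct H (omegaAlg φ a) η) = star a * omegaForm H φ ξ η := by
  rw [← star_omegaForm, omegaForm_act_left, star_mul_comm, star_omegaForm]

lemma omegaForm_sum_left {ι : Type*} (s : Finset ι) (ξ : ι → ⨂[ℂ] i, H i) (η : ⨂[ℂ] i, H i) :
    omegaForm H φ (∑ k ∈ s, ξ k) η = ∑ k ∈ s, omegaForm H φ (ξ k) η :=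
  map_sum (AddMonoidHom.mk' (fun ξ => omegaForm H φ ξ η)
    fun ξ ξ' => omegaForm_add_left H φ ξ ξ' η) _ _

lemma omegaForm_sum_right {ι : Type*} (s : Finset ι) (ξ : ⨂[ℂ] i, H i) (η : ι → ⨂[ℂ] i, H i) :
    omegaForm H φ ξ (∑ k ∈ s, η k) = ∑ k ∈ s, omegaForm H φ ξ (η k) :=
  map_sum (AddMonoidHom.mk' (fun η => omegaForm H φ ξ η)
    fun η η' => omegaForm_add_right H φ ξ η η') _ _

end TensorForm

/-! ### Orthonormal expansions, positivity and definiteness. -/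

section OrthonormalDecomposition

open PiTensorProduct Filter Function

variable {I : Type*} {H : I → Type*} [∀ i, NormedAddCommGroup (H i)]
  [∀ i, InnerProductSpace ℂ (H i)]

/-- A tensor `⊗ x_i` with `x_i` in the span of `S_i` for all `i` and in `S_i` for almost all `i` is
a linear combination of tensors `⊗ e_i` with `e_i` in `S_i`. -/
lemma tprod_mem_span_of_mem_span {M : I → Type*} [∀ i, AddCommGroup (M i)] [∀ i, Module ℂ (M i)]
    (S : Π i, Set (M i)) (F : Finset I) (x : Π i, M i)
    (h : ∀ i ∈ F, x i ∈ Submodule.span ℂ (S i)) (h' : ∀ i ∉ F, x i ∈ S i) :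
    tprod ℂ x ∈ Submodule.span ℂ (PiTensorProduct.tprod ℂ '' {e : Π i, M i | ∀ i, e i ∈ S i}) := by
  classical
  induction F using Finset.induction_on generalizing x with
  | empty => exact Submodule.subset_span ⟨x, fun i => h' i (Finset.notMem_empty i), rfl⟩
  | insert j F hj ih =>
    have key : ∀ v ∈ Submodule.span ℂ (S j), tprod ℂ (update x j v) ∈
        Submodule.span ℂ (PiTensorProduct.tprod ℂ '' {e : Π i, M i | ∀ i, e i ∈ S i}) :=
        fun v hv => by
      induction hv using Submodule.span_induction with
      | mem v hv =>
        refine ih _ (fun i hi => ?_) fun i hi => ?_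
        · rw [update_of_ne (by rintro rfl; exact hj hi)]
          exact h i (Finset.mem_insert_of_mem hi)
        · rcases eq_or_ne i j with rfl | hij
          · rwa [update_self]
          · rw [update_of_ne hij]
            exact h' i (by simp [hij, hi])
      | zero =>
        rw [MultilinearMap.map_coord_zero _ j (update_self _ _ _)]
        exact Submodule.zero_mem _
      | add v w _ _ hv hw =>
        rw [MultilinearMap.map_update_add]
        exact Submodule.add_mem _ hv hw
      | smul t v _ hv =>
        rw [MultilinearMap.map_update_smul]
        exact Submodule.smul_mem _ _ hv
    simpa using key _ (h j (Finset.mem_insert_self _ _))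

lemma exists_orthonormal_span {E : Type*} [NormedAddCommGroup E] [InnerProductSpace ℂ E]
    {X : Set E} (hX : X.Finite) : ∃ B : Set E, (∀ u ∈ B, ‖u‖ = 1) ∧
      (∀ u ∈ B, ∀ v ∈ B, u ≠ v → inner ℂ u v = 0) ∧ X ⊆ Submodule.span ℂ B := by
  have := FiniteDimensional.span_of_finite ℂ hX
  let b := stdOrthonormalBasis ℂ (Submodule.span ℂ X)
  refine ⟨Set.range fun j => (b j : E), ?_, ?_, fun x hx => ?_⟩
  · rintro _ ⟨j, rfl⟩
    exact b.norm_eq_one j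
  · rintro _ ⟨j, rfl⟩ _ ⟨k, rfl⟩ hjk
    exact b.inner_eq_zero fun h => hjk (by rw [h])
  · have h := congrArg (Submodule.subtype _) (b.sum_repr ⟨x, Submodule.subset_span hx⟩)
    rw [map_sum] at h
    rw [SetLike.mem_coe, ← show _ = x from h]
    exact Submodule.sum_mem _ fun j _ => Submodule.smul_mem _ _ (Submodule.subset_span ⟨j, rfl⟩)

variable (H) in
/-- Two families are equivalent if they agree e.f. up to factors of modulus one. -/
def circleSetoid : Setoid (Π i, H i) where
  r x y := ∃ α : I → Circle, AgreeEF x fun i => (α i : ℂ) • y i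
  iseqv :=
    { refl := fun x => ⟨1, Eventually.of_forall fun i => by simp⟩
      symm := fun {x y} ⟨α, hα⟩ => ⟨α⁻¹, by
        filter_upwards [hα] with i hi
        rw [hi, smul_smul, Pi.inv_apply, Circle.coe_inv, inv_mul_cancel₀ (Circle.coe_ne_zero _),
          one_smul]⟩
      trans := fun {x y z} ⟨α, hα⟩ ⟨γ, hγ⟩ => ⟨α * γ, by
        filter_upwards [hα, hγ] with i hi hi'
        rw [hi, hi', smul_smul, Pi.mul_apply, Circle.coe_mul]⟩ }

/-- This is the equality case of Cauchy-Schwarz: unit vectors with an inner product of modulus one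
are proportional. Consequently inequivalent families of unit vectors have `omegaForm` equal to zero.
-/
lemma circleSetoid_of_inner {x y : Π i, H i} (hx : ∀ i, ‖x i‖ = 1) (hy : ∀ i, ‖y i‖ = 1)
    (α : I → Circle) (h : AgreeEF (fun i => inner ℂ (y i) (x i)) fun i => (α i : ℂ)) :
    circleSetoid H x y := by
  refine ⟨α, ?_⟩
  filter_upwards [h] with i hi
  have hn : ‖(α i : ℂ) • y i‖ = 1 := by rw [norm_smul, hy, Circle.norm_coe, one_mul]
  refine ((inner_eq_one_iff_of_norm_eq_one (𝕜 := ℂ) hn (hx i)).1 ?_).symm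
  rw [inner_smul_left, hi, ← Circle.coe_inv_eq_conj, Circle.coe_inv,
    inv_mul_cancel₀ (Circle.coe_ne_zero _)]

variable (φ : CircleProd I)

lemma omegaForm_tprod_self {x : Π i, H i} (hx : ∀ i, ‖x i‖ = 1) :
    omegaForm H φ (tprod ℂ x) (tprod ℂ x) = 1 := by
  have h : (fun i => inner ℂ (x i) (x i)) = fun _ => (1 : ℂ) := by
    funext i
    simp [inner_self_eq_norm_sq_to_K, hx]
  rw [omegaForm, tensorForm_tprod, h, omegaCoord_tprod φ (α := 1)
    (Eventually.of_forall fun i => by simp)]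
  simp [MonoidAlgebra.one_def]

/-- Finitely many tensors of unit vectors lie in the span, up to factors of modulus one, of tensors
of unit vectors that are orthonormal for the `ℂ[Ω]`-valued form. -/
lemma exists_orthonormal_families {X : Set (Π i, H i)} (hX : X.Finite)
    (hu : ∀ x ∈ X, ∀ i, ‖x i‖ = 1) : ∃ E : Set (Π i, H i), (∀ e ∈ E, ∀ i, ‖e i‖ = 1) ∧
      (∀ e ∈ E, ∀ e' ∈ E, e ≠ e' → omegaForm H φ (tprod ℂ e) (tprod ℂ e') = 0) ∧
      ∀ x ∈ X, ∃ α : I → Circle, ∃ v ∈ Submodule.span ℂ (PiTensorProduct.tprod ℂ '' E),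
        tprod ℂ x = tensorAct H (tprod ℂ fun i => (α i : ℂ)) v := by
  classical
  let s := circleSetoid H
  let rep : (Π i, H i) → (Π i, H i) := fun x => (Quotient.mk s x).out
  have hrep : ∀ x, circleSetoid H x (rep x) := fun x =>
    s.symm' (Quotient.mk_out (s := s) x)
  choose α hα using hrep
  have hF : ∀ᶠ i in cofinite, ∀ x ∈ X, x i = (α x i : ℂ) • rep x i :=
    (eventually_all_finite hX).2 fun x _ => hα x
  -- One finite set serves all of `X`: off `F`, every family in `X` is a circle multiple of its
  -- class representative.
  let F : Finset I := Set.Finite.toFinset (s := {i | ¬ ∀ x ∈ X, x i = (α x i : ℂ) • rep x i}) hF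
  have hF' : ∀ i ∉ F, ∀ x ∈ X, x i = (α x i : ℂ) • rep x i := fun i hi => by
    simpa [F] using hi
  choose B hB1 hB2 hB3 using fun i => exists_orthonormal_span (hX.image fun x => x i)
  -- The orthonormal families take arbitrary values in the orthonormal sets `B i` on `F` and are
  -- frozen to a representative off `F`.
  let S : (Π i, H i) → Π i, Set (H i) := fun r i => if i ∈ F then B i else {r i}
  have hS : ∀ x e : Π i, H i, (∀ i, e i ∈ S (rep x) i) → ∀ i ∉ F, e i = rep x i :=
    fun x e he i hi => by simpa [S, hi] using he i
  have hS' : ∀ x e : Π i, H i, (∀ i, e i ∈ S (rep x) i) → ∀ i ∈ F, e i ∈ B i :=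
    fun x e he i hi => by simpa [S, hi] using he i
  have hS2 : ∀ x e : Π i, H i, (∀ i, e i ∈ S (rep x) i) → circleSetoid H e x :=
    fun x e he => by
      refine s.trans' ?_ (Quotient.mk_out (s := s) x)
      refine ⟨1, ?_⟩
      filter_upwards [(F.finite_toSet.compl_mem_cofinite : (↑F : Set I)ᶜ ∈ cofinite)] with i hi
      rw [hS x e he i hi]
      simp [rep]
  have hunit : ∀ x ∈ X, ∀ e : Π i, H i, (∀ i, e i ∈ S (rep x) i) → ∀ i, ‖e i‖ = 1 :=
    fun x hx e he i => by
      by_cases hi : i ∈ F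
      · exact hB1 i _ (hS' x e he i hi)
      -- Representatives are chosen among all families and need not be unit vectors on `F`; off `F`
      -- they inherit norm one from `x`.
      · have h := hu x hx i
        rw [hF' i hi x hx, norm_smul, Circle.norm_coe, one_mul] at h
        rw [hS x e he i hi, h]
  refine ⟨{e | ∃ x ∈ X, ∀ i, e i ∈ S (rep x) i}, ?_, ?_, ?_⟩
  · rintro e ⟨x, hx, he⟩
    exact hunit x hx e he
  · rintro e ⟨x, hx, he⟩ e' ⟨x', hx', he'⟩ hne
    by_contra h
    rw [omegaForm, tensorForm_tprod] at h
    -- A nonzero form puts both families in one class, so they share a representative and can differ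
    -- only on `F`, where distinct vectors of `B i` are orthogonal and make one tensor factor zero.
    obtain ⟨γ, hγ⟩ := not_not.1 (mt (omegaCoord_tprod_of_not φ) h)
    have h1 := circleSetoid_of_inner (hunit x hx e he) (hunit x' hx' e' he') γ hγ
    have h2 : rep x = rep x' := congrArg Quotient.out (Quotient.sound (s := s)
      (s.trans' (s.symm' (hS2 x e he)) (s.trans' h1 (hS2 x' e' he'))))
    obtain ⟨i, hi⟩ := Function.ne_iff.1 hne
    by_cases hiF : i ∈ F
    · refine h ?_
      rw [MultilinearMap.map_coord_zero _ i, map_zero]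
      exact hB2 i _ (hS' x' e' he' i hiF) _ (hS' x e he i hiF) hi.symm
    · exact hi (by rw [hS x e he i hiF, hS x' e' he' i hiF, h2])
  · intro x hx
    -- The circle factors off `F` move into the scalar tensor, while on `F` the vectors `x i` are
    -- expanded in `B i`.
    refine ⟨fun i => if i ∈ F then 1 else α x i,
      tprod ℂ fun i => if i ∈ F then x i else rep x i, ?_, ?_⟩
    · refine Submodule.span_mono (Set.image_mono ?_)
        (tprod_mem_span_of_mem_span (S (rep x)) F _ (fun i hi => ?_) fun i hi => ?_)
      · exact fun e he => ⟨x, hx, he⟩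
      · simp only [S, hi, if_true]
        exact hB3 i ⟨x, hx, rfl⟩
      · simp [S, hi]
    · rw [tensorAct_tprod]
      congr 1
      funext i
      by_cases hi : i ∈ F
      · simp [hi]
      · simpa [hi] using hF' i hi x hx

/-- Every element of `⊗^un H_i` has an expansion in orthonormal tensors with coefficients in
`ℂ[Ω]`. -/
lemma exists_orthonormal_expansion {ξ : ⨂[ℂ] i, H i} (hξ : ξ ∈ unTensor H) :
    ∃ (s : Finset (Π i, H i)) (a : (Π i, H i) → MonoidAlgebra ℂ (OmegaUt I)),
      ξ = ∑ e ∈ s, tensorAct H (omegaAlg φ (a e)) (tprod ℂ e) ∧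
      omegaForm H φ ξ ξ = ∑ e ∈ s, a e * star (a e) := by
  classical
  obtain ⟨T, hT, hξT⟩ := Submodule.mem_span_finite_of_mem_span hξ
  choose! x hx1 hx2 using fun (t : ⨂[ℂ] i, H i) (ht : t ∈ (T : Set (⨂[ℂ] i, H i))) => hT ht
  obtain ⟨E, hE1, hE2, hE3⟩ := exists_orthonormal_families φ (X := x '' T)
    (T.finite_toSet.image x) (by rintro _ ⟨t, ht, rfl⟩; exact hx1 t ht)
  let L : (E →₀ MonoidAlgebra ℂ (OmegaUt I)) →ₗ[ℂ] ⨂[ℂ] i, H i :=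
    Finsupp.lsum ℂ fun e => (tensorAct H).flip (tprod ℂ (e : Π i, H i)) ∘ₗ (omegaAlg φ).toLinearMap
  have hL : ∀ a, L a = ∑ e ∈ a.support, tensorAct H (omegaAlg φ (a e)) (tprod ℂ (e : Π i, H i)) :=
    fun a => rfl
  have hLT : (T : Set (⨂[ℂ] i, H i)) ⊆ LinearMap.range L := fun t ht => by
    obtain ⟨α, v, hv, h⟩ := hE3 (x t) ⟨t, ht, rfl⟩
    rw [hx2 t ht, h]
    clear h
    induction hv using Submodule.span_induction with
    | mem v hv =>
      obtain ⟨e, he, rfl⟩ := hv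
      -- The coefficient `φ(α)` cancels the `φ(α)⁻¹` in `Ψ(λ_{[α]})`, so this element acts as `⊗
      -- α_i`.
      refine ⟨Finsupp.single ⟨e, he⟩ (MonoidAlgebra.single (QuotientGroup.mk α) (φ.toHom α)), ?_⟩
      have : omegaAlg φ (MonoidAlgebra.single (QuotientGroup.mk α) (φ.toHom α : ℂ))
          = tprod ℂ fun i => (α i : ℂ) := by
        rw [omegaAlg_single, mul_inv_cancel₀ (Circle.coe_ne_zero _), one_smul]
      simp [L, this]
    | zero => rw [map_zero]; exact Submodule.zero_mem _
    | add v w _ _ hv hw => rw [map_add]; exact Submodule.add_mem _ hv hw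
    | smul t v _ hv => rw [map_smul]; exact Submodule.smul_mem _ _ hv
  obtain ⟨a, rfl⟩ := Submodule.span_le.2 hLT hξT
  let a' : (Π i, H i) → MonoidAlgebra ℂ (OmegaUt I) := fun e => if h : e ∈ E then a ⟨e, h⟩ else 0
  have ha' : ∀ e : E, a' e = a e := fun e => by simp [a']
  refine ⟨a.support.map (Embedding.subtype _), a', ?_, ?_⟩
  · rw [Finset.sum_map, hL]
    exact Finset.sum_congr rfl fun e _ => by rw [Embedding.coe_subtype, ha']
  · rw [Finset.sum_map, hL, omegaForm_sum_left]
    refine Finset.sum_congr rfl fun e he => ?_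
    -- Orthogonality leaves only the diagonal terms of the double sum, each equal to `a_e ⟨e, e⟩
    -- a_e* = a_e a_e*`.
    rw [omegaForm_sum_right, Finset.sum_eq_single_of_mem e he, Embedding.coe_subtype, ha',
      omegaForm_act_left, omegaForm_act_right, omegaForm_tprod_self φ (hE1 e e.2), mul_one]
    intro e' _ hne
    rw [omegaForm_act_left, omegaForm_act_right,
      hE2 e e.2 e' e'.2 fun h => hne (Subtype.ext h.symm), mul_zero, mul_zero]

lemma omegaForm_self_nonneg {ξ : ⨂[ℂ] i, H i} (hξ : ξ ∈ unTensor H) :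
    0 ≤ GroupCStar.of (omegaForm H φ ξ ξ) := by
  obtain ⟨s, a, -, h⟩ := exists_orthonormal_expansion φ hξ
  rw [h, map_sum]
  refine Finset.sum_nonneg fun e _ => ?_
  rw [map_mul, map_star]
  exact mul_star_self_nonneg _

lemma coeff_one_omegaForm_self_nonneg {ξ : ⨂[ℂ] i, H i} (hξ : ξ ∈ unTensor H) :
    0 ≤ (omegaForm H φ ξ ξ).coeff 1 := by
  obtain ⟨s, a, -, h⟩ := exists_orthonormal_expansion φ hξ
  rw [h, MonoidAlgebra.coeff_sum, Finsupp.finsetSum_apply]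
  exact Finset.sum_nonneg fun e _ => coeff_one_mul_star_self_nonneg _

lemma eq_zero_of_coeff_one_omegaForm_self {ξ : ⨂[ℂ] i, H i} (hξ : ξ ∈ unTensor H)
    (h0 : (omegaForm H φ ξ ξ).coeff 1 = 0) : ξ = 0 := by
  obtain ⟨s, a, hs, h⟩ := exists_orthonormal_expansion φ hξ
  rw [h, MonoidAlgebra.coeff_sum, Finsupp.finsetSum_apply,
    Finset.sum_eq_zero_iff_of_nonneg fun e _ => coeff_one_mul_star_self_nonneg _] at h0
  rw [hs]
  refine Finset.sum_eq_zero fun e he => ?_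
  rw [eq_zero_of_coeff_one_mul_star_self (h0 e he), map_zero, map_zero, LinearMap.zero_apply]

end OrthonormalDecomposition

/-! ### The inner-product modules and the two isomorphisms. -/

section Modules

open PiTensorProduct Filter Function

variable {I : Type*} (H : I → Type*) [∀ i, NormedAddCommGroup (H i)]
  [∀ i, InnerProductSpace ℂ (H i)] (φ : CircleProd I)

/-- The inner-product `ℂ[Ω]`-module `⊗^un H_i`. -/
def omegaModule : GroupInnerModule (OmegaUt I) (unTensor H) where
  act := AlgHom.ofLinearMap
    { toFun := fun a => (tensorAct H (omegaAlg φ a)).restrict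
        fun _ hξ => tensorAct_omegaAlg_mem H φ a hξ
      map_add' := fun a b => LinearMap.ext fun ξ => Subtype.ext <| by simp
      map_smul' := fun z a => LinearMap.ext fun ξ => Subtype.ext <| by simp }
    (LinearMap.ext fun ξ => Subtype.ext <| by simp [tensorAct_one])
    (fun a b => LinearMap.ext fun ξ => Subtype.ext <| by simp [tensorAct_mul])
  form ξ η := omegaForm H φ ξ η
  form_add_left ξ ξ' η := omegaForm_add_left H φ ξ ξ' η
  form_act_left a ξ η := omegaForm_act_left H φ a ξ η
  star_form ξ η := star_omegaForm H φ ξ η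
  form_self_nonneg ξ := omegaForm_self_nonneg φ ξ.2
  form_definite ξ h := Subtype.ext <|
    eq_zero_of_coeff_one_omegaForm_self φ ξ.2 <| by rw [h]; rfl

lemma omegaModule_form (ξ η : unTensor H) :
    (omegaModule H φ).form ξ η = omegaForm H φ ξ η := rfl

lemma phiOne_tensorForm (ξ η : ⨂[ℂ] i, H i) :
    phiOne I (tensorForm H ξ η) = (omegaForm H φ ξ η).coeff 1 :=
  (omegaCoord_coeff_one φ _).symm

-- The scalar form does not depend on `φ`, so an auxiliary `φ` may be chosen to express it as the
-- trace of `omegaForm`.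
variable {H} in
lemma phiOne_tensorForm_self_nonneg {ξ : ⨂[ℂ] i, H i} (hξ : ξ ∈ unTensor H) :
    0 ≤ phiOne I (tensorForm H ξ ξ) := by
  obtain ⟨φ⟩ := nonempty_circleProd (I := I)
  rw [phiOne_tensorForm H φ]
  exact coeff_one_omegaForm_self_nonneg φ hξ

lemma star_phiOne_tensorForm (ξ η : ⨂[ℂ] i, H i) :
    star (phiOne I (tensorForm H ξ η)) = phiOne I (tensorForm H η ξ) := by
  obtain ⟨φ⟩ := nonempty_circleProd (I := I)
  rw [phiOne_tensorForm H φ, phiOne_tensorForm H φ, ← star_omegaForm H φ ξ η, coeff_star, inv_one]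

/-- The inner product `φ₁⟨ξ, η⟩` on `⊗^un H_i`. -/
abbrev phiOneCore : InnerProductSpace.Core ℂ (unTensor H) where
  inner η ξ := phiOne I (tensorForm H ξ η)
  conj_inner_symm η ξ := star_phiOne_tensorForm H η ξ
  re_inner_nonneg ξ := (Complex.nonneg_iff.1 (phiOne_tensorForm_self_nonneg ξ.2)).1
  add_left ξ η ζ := by
    rw [Submodule.coe_add, tensorForm_add_right, map_add]
  smul_left ξ η z := by
    rw [← star_phiOne_tensorForm, Submodule.coe_smul, tensorForm_smul_left, map_smul,
      smul_eq_mul, star_mul', star_phiOne_tensorForm]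
    rfl
  definite ξ h := by
    obtain ⟨φ⟩ := nonempty_circleProd (I := I)
    exact Subtype.ext (eq_zero_of_coeff_one_omegaForm_self φ ξ.2
      ((phiOne_tensorForm H φ _ _).symm.trans h))

lemma norm_toHilbertCompletion (ξ : unTensor H) :
    ‖toHilbertCompletion (phiOneCore H) ξ‖ = √‖phiOne I (tensorForm H ξ ξ)‖ := by
  have h : ‖toHilbertCompletion (phiOneCore H) ξ‖ = √(phiOne I (tensorForm H ξ ξ)).re :=
    Completion.norm_coe (E := InnerSpace (phiOneCore H)) ξ
  rw [h, Complex.re_eq_norm.2 (phiOne_tensorForm_self_nonneg ξ.2)]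

lemma denseRange_toHilbertCompletion {V : Type*} [AddCommGroup V] [Module ℂ V]
    (c : InnerProductSpace.Core ℂ V) : DenseRange (toHilbertCompletion c) :=
  Completion.denseRange_coe (α := InnerSpace c)

/-- Both norms of `ξ` come from the same number, `χ⟨ξ, ξ⟩ = φ₁⟨ξ, ξ⟩`, and the vectors `ξ ⊗ 1` are
dense because `ξ ⊗ z = zξ ⊗ 1`. -/
lemma exists_hilbertSpace_iso (χ : GroupCStar (OmegaUt I) →ₚ[ℂ] ℂ)
    (hχ : ∀ a : MonoidAlgebra ℂ (OmegaUt I), χ (GroupCStar.of a) = a.coeff 1) :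
    ∃ U : HilbertCompletion (phiOneCore H) ≃ₗᵢ[ℂ]
        (interiorTensor (omegaModule H φ).Compl χ).Compl,
      ∀ ξ : unTensor H, U (toHilbertCompletion (phiOneCore H) ξ) =
        (interiorTensor (omegaModule H φ).Compl χ).toCompl
          ((omegaModule H φ).toCompl ξ ⊗ₜ[ℂ] 1) := by
  refine exists_linearIsometryEquiv (toHilbertCompletion (phiOneCore H))
    ((interiorTmul χ).flip 1 ∘ₗ (omegaModule H φ).toCompl)
    (denseRange_toHilbertCompletion _)
    (denseRange_interiorTmul_one χ _ (PreHilbertModule.denseRange_toCompl _) (id : ℂ → ℂ)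
      denseRange_id (fun z ξ => z • ξ) fun z ξ => ?_) fun ξ => ?_
  · rw [map_smul, map_smul, LinearMap.smul_apply, ← map_smul, smul_eq_mul, mul_one]; rfl
  · have hn : ‖(interiorTensor _ χ).toCompl ((omegaModule H φ).toCompl ξ ⊗ₜ[ℂ] 1)‖
        = √‖1 * star 1 * χ (inner (GroupCStar (OmegaUt I)) ((omegaModule H φ).toCompl ξ)
          ((omegaModule H φ).toCompl ξ))‖ := PreHilbertModule.norm_toCompl _ _
    have hi : inner (GroupCStar (OmegaUt I)) ((omegaModule H φ).toCompl ξ)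
        ((omegaModule H φ).toCompl ξ) = GroupCStar.of ((omegaModule H φ).form ξ ξ) :=
      (omegaModule H φ).toPre.inner_toCompl ξ ξ
    rw [hi, hχ, star_one, one_mul, one_mul, omegaModule_form, ← phiOne_tensorForm] at hn
    exact hn.trans (norm_toHilbertCompletion H ξ).symm

/-- The inner-product module over the group algebra of a subgroup obtained by restricting the action
and the form. -/
def restrictModule {Ω X : Type*} [CommGroup Ω] [AddCommGroup X] [Module ℂ X]
    (S : GroupInnerModule Ω X) (hS : ∀ x, (S.form x x).coeff 1 = 0 → x = 0) (G : Subgroup Ω) :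
    GroupInnerModule G X where
  act := S.act.comp (includeSubgroup G)
  form ξ η := restrictₗ G (S.form ξ η)
  form_add_left ξ ξ' η := by rw [S.form_add_left, map_add]
  form_act_left a ξ η := by
    rw [AlgHom.comp_apply, S.form_act_left, restrictₗ_include_mul]
  star_form ξ η := by
    rw [restrictₗ_apply, restrictₗ_apply, ← restrictSubgroup_star, S.star_form]
  form_self_nonneg ξ := by
    -- The restricted form is the image of a positive element of `C*(Ω)` under a positive map.
    obtain ⟨E, hE⟩ := exists_conditionalExpectation G
    rw [restrictₗ_apply, ← hE]
    exact map_nonneg E (S.form_self_nonneg ξ)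
  -- The identity lies in `G`, so the coefficient at `1` survives restriction and alone detects `ξ =
  -- 0`; definiteness of `S.form` by itself is not what is used.
  form_definite ξ h := hS ξ (by
    have := congrArg (fun a : MonoidAlgebra ℂ G => a.coeff 1) h
    exact this)

/-- The map `x ↦ x ⊗ 1` turns `⟨x, y⟩` into `E⟨x, y⟩`, which is the restricted form. Density rests
on `x ⊗ a = ax ⊗ 1` for `a` in `ℂ[G]`: by the `ℂ[G]`-linearity of `E`, the two tensors have the
inner products demanded by `interiorTensor_toCompl_eq`. -/
lemma exists_hilbertModule_iso {Ω X : Type*} [CommGroup Ω] [AddCommGroup X] [Module ℂ X]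
    (S : GroupInnerModule Ω X) (hS : ∀ x, (S.form x x).coeff 1 = 0 → x = 0) (G : Subgroup Ω)
    (E : GroupCStar Ω →ₚ[ℂ] GroupCStar G)
    (hE : ∀ a : MonoidAlgebra ℂ Ω, E (GroupCStar.of a) = GroupCStar.of (restrictSubgroup G a)) :
    ∃ W : (restrictModule S hS G).Compl ≃ₗᵢ[ℂ] (interiorTensor S.Compl E).Compl,
      (∀ (b : GroupCStar G) (x : (restrictModule S hS G).Compl), W (b • x) = b • W x) ∧
      (∀ x y : (restrictModule S hS G).Compl,
        inner (GroupCStar G) (W x) (W y) = inner (GroupCStar G) x y) ∧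
      ∀ x, W ((restrictModule S hS G).toCompl x) =
        (interiorTensor S.Compl E).toCompl (S.toCompl x ⊗ₜ[ℂ] 1) := by
  have hi : ∀ x y, (inner (GroupCStar Ω) (S.toCompl x) (S.toCompl y) : GroupCStar Ω)
      = GroupCStar.of (S.form y x) := fun x y => S.toPre.inner_toCompl x y
  have hr : ∀ a x y, S.form x (S.act a y) = star a * S.form x y := fun a x y => by
    rw [← S.star_form, S.form_act_left, star_mul_comm, S.star_form]
  have hinc : ∀ (a : MonoidAlgebra ℂ G) (b : MonoidAlgebra ℂ Ω),
      E (GroupCStar.of (includeSubgroup G a * b)) = GroupCStar.of a * E (GroupCStar.of b) :=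
    fun a b => by
      rw [hE, hE, ← restrictₗ_apply, restrictₗ_include_mul, map_mul, restrictₗ_apply]
  refine PreHilbertModule.exists_unitary (restrictModule S hS G).toPre (interiorTensor S.Compl E)
    ((interiorTmul E).flip 1 ∘ₗ S.toCompl)
    (denseRange_interiorTmul_one E S.toCompl (PreHilbertModule.denseRange_toCompl _)
      (GroupCStar.of (G := G)) GroupCStar.denseRange_of
      (fun a x => S.act (includeSubgroup G a) x) fun a x => ?_) fun x y => ?_
  · refine interiorTensor_toCompl_eq ?_ ?_
    · rw [hi, hi, hr, ← includeSubgroup_star, hinc, map_star, star_one]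
      ring
    · rw [hi, hi, S.form_act_left, S.form_act_left, hr, ← includeSubgroup_star, hinc, hinc, hinc,
        map_star, star_one]
      ring
  · refine (inner_interiorTensor_tmul E (S.toCompl y) (S.toCompl x) 1 1).trans ?_
    rw [hi, hE, star_one, one_mul, one_mul]
    rfl

end Modules

end HilbTensor

end

/-! ### The main theorem. -/

theorem mainTheorem5 {I : Type*} [Infinite I] (H : I → Type*) [∀ i, NormedAddCommGroup (H i)]
    [∀ i, InnerProductSpace ℂ (H i)] [∀ i, Nontrivial (H i)] :
    Nonempty (CircleProd I) ∧
    -- `⟨·,·⟩_{φ₁}` is an inner product `c` on `⨂^un H_i`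
    ∃ c : InnerProductSpace.Core ℂ (unTensor H),
      (∀ ξ η : unTensor H, c.inner η ξ = phiOne I (tensorForm H ξ η)) ∧
      ∀ φ : CircleProd I,
        -- the inner-product `ℂ[Ω]`-module structure `S` on `⨂^un H_i`
        ∃ S : GroupInnerModule (OmegaUt I) (unTensor H),
          (∀ (a : MonoidAlgebra ℂ (OmegaUt I)) (ξ : unTensor H),
            (S.act a ξ : ⨂[ℂ] i, H i) = tensorAct H (omegaAlg φ a) ξ) ∧
          (∀ ξ η : unTensor H,
            omegaAlg φ (S.form ξ η) = truncation ⊤ (tensorForm H ξ η)) ∧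
          -- the canonical trace `χ` and the Hilbert space isomorphism
          (∃ χ : GroupCStar (OmegaUt I) →ₚ[ℂ] ℂ,
            (∀ a : MonoidAlgebra ℂ (OmegaUt I), χ (GroupCStar.of a) = a.coeff 1) ∧
            ∃ U : HilbertCompletion c ≃ₗᵢ[ℂ] (interiorTensor S.Compl χ).Compl,
              ∀ ξ : unTensor H, U (toHilbertCompletion c ξ) =
                (interiorTensor S.Compl χ).toCompl (S.toCompl ξ ⊗ₜ[ℂ] 1)) ∧
          ∀ G : Subgroup (OmegaUt I),
            -- the inner-product `ℂ[G]`-module structure `T` on `⨂^un H_i`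
            ∃ T : GroupInnerModule G (unTensor H),
              (∀ (a : MonoidAlgebra ℂ G) (ξ : unTensor H),
                T.act a ξ = S.act (includeSubgroup G a) ξ) ∧
              (∀ ξ η : unTensor H,
                omegaAlg φ (includeSubgroup G (T.form ξ η)) = truncation G (tensorForm H ξ η)) ∧
              -- the canonical conditional expectation `E` and the isomorphism of Hilbert modules
              ∃ E : GroupCStar (OmegaUt I) →ₚ[ℂ] GroupCStar G,
                (∀ a : MonoidAlgebra ℂ (OmegaUt I),
                  E (GroupCStar.of a) = GroupCStar.of (restrictSubgroup G a)) ∧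
                ∃ W : T.Compl ≃ₗᵢ[ℂ] (interiorTensor S.Compl E).Compl,
                  (∀ (b : GroupCStar G) (x : T.Compl), W (b • x) = b • W x) ∧
                  (∀ x y : T.Compl,
                    inner (GroupCStar G) (W x) (W y) = inner (GroupCStar G) x y) ∧
                  ∀ ξ : unTensor H, W (T.toCompl ξ) =
                    (interiorTensor S.Compl E).toCompl (S.toCompl ξ ⊗ₜ[ℂ] 1) := by
  refine ⟨nonempty_circleProd, phiOneCore H, fun _ _ => rfl, fun φ => ?_⟩
  refine ⟨omegaModule H φ, fun _ _ => rfl, fun ξ η => omegaAlg_omegaCoord φ _, ?_, fun G => ?_⟩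
  · obtain ⟨χ, hχ⟩ := exists_trace (G := OmegaUt I)
    exact ⟨χ, hχ, exists_hilbertSpace_iso H φ χ hχ⟩
  · have hS : ∀ ξ, ((omegaModule H φ).form ξ ξ).coeff 1 = 0 → ξ = 0 := fun ξ h =>
      Subtype.ext (eq_zero_of_coeff_one_omegaForm_self φ ξ.2 h)
    obtain ⟨E, hE⟩ := exists_conditionalExpectation G
    exact ⟨restrictModule _ hS G, fun _ _ => rfl,
      fun ξ η => omegaAlg_restrict_omegaCoord φ G _, E, hE, exists_hilbertModule_iso _ hS G E hE⟩
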